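/- Let $K$ be a field and let $G$ be a finite simple graph on a vertex set $V$; let $S=K[x_i : i\in V]$ with the standard grading. A $k$-matching of $G$ is a set of $k$ pairwise disjoint edges, and $\nu(G)$ is the maximal size of a matching. For a graph $H$ whose vertex set is contained in $V$, let $I(H)^{[k]}\subset S$ be the ideal generated by the monomials $\prod_{i\in V(M)}x_i$, where $M$ runs over the $k$-matchings of $H$ and $V(M)$ is the set of vertices covered by $M$ (so $I(H)^{[1]}$ is the edge ideal of $H$ and $I(H)^{[0]}=S$). For a monomial ideal $I$ let $\mathcal G(I)$ be its set of minimal monomial generators and let $\beta_{i,j}(I)$ be its graded Betti numbers, i.e. the number of basis elements of degree $j$ in step $i$ of the minimal graded free resolution of $I$, with $\beta_{-1,j}=0$. For monomial ideals, $I=I_1+I_2$ is a Betti splitting if $\mathcal G(I)$ is the disjoint union of $\mathcal G(I_1)$ and $\mathcal G(I_2)$ and $$\beta_{i,j}(I)=\beta_{i,j}(I_1)+\beta_{i,j}(I_2)+\beta_{i-1,j}(I_1\cap I_2)\qquad\text{for all } i,j\ge 0.$$ Let $G$ be a forest with $\nu(G)\ge 3$, and let $v,w,u$ be vertices of $G$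 with $u\neq v$ such that $N_G(w)=\{i_1,\dots,i_t,u,v\}$, where $t\ge 0$, the listed vertices are distinct, $\deg_G(v)=1$ and $\deg_G(i_j)=1$ for $j=1,\dots,t$ (so $\{w,v\}$ is a distant edge of $G$). Let $G_1,G_2,G_3$ be the induced subgraphs of $G$ on $V\setminus\{v\}$, $V\setminus\{v,w\}$ and $V\setminus\{v,w,u\}$, respectively. Then for all $1\le k\le\nu(G)$, $$I(G)^{[k]}=I(G_1)^{[k]}+x_vx_w\,I(G_2)^{[k-1]}$$ is a Betti splitting, and $$I(G_1)^{[k]}\cap x_vx_w\,I(G_2)^{[k-1]}=x_vx_w\Big[I(G_3)^{[k]}+x_u\,I(G_3)^{[k-1]}+\sum_{j=1}^{t}x_{i_j}\,I(G_2)^{[k-1]}\Big].$$ -/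

import Mathlib

open MvPolynomial

noncomputable section

/-! ## Graded Betti numbers -/

/-- A minimal graded free resolution
`⋯ → F_2 → F_1 → F_0 → I → 0` of an ideal `I` of the standard graded polynomial ring
`S = K[x_i : i ∈ σ]`.  Here `F_i = ⨁_a S(-deg i a)`, with `a` running over `Fin (rank i)`; the maps
are given by matrices with respect to the standard bases, and all maps are homogeneous of
degree `0`. -/
structure MinimalGradedFreeResolution {σ K : Type*} [Field K] (I : Ideal (MvPolynomial σ K)) where
  /-- the rank of `F_i` -/
  rank : ℕ → ℕ
  /-- the degree of the `a`-th basis element of `F_i` -/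
  deg : (i : ℕ) → Fin (rank i) → ℕ
  /-- the images in `I` of the basis elements of `F_0` -/
  gen : Fin (rank 0) → MvPolynomial σ K
  /-- the matrix of `F_{i+1} → F_i` -/
  d : (i : ℕ) → Matrix (Fin (rank i)) (Fin (rank (i + 1))) (MvPolynomial σ K)
  gen_homogeneous : ∀ a, (gen a).IsHomogeneous (deg 0 a)
  d_homogeneous : ∀ i a b, d i a b ≠ 0 →
    ∃ m, m + deg i a = deg (i + 1) b ∧ (d i a b).IsHomogeneous m
  /-- `F_0 → I` is onto -/
  span_gen : Ideal.span (Set.range gen) = I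
  /-- exactness at `F_0` -/
  exact_zero : ∀ x : Fin (rank 0) → MvPolynomial σ K,
    ∑ a, x a * gen a = 0 ↔ ∃ y, (d 0).mulVec y = x
  /-- exactness at `F_{i+1}` -/
  exact_succ : ∀ (i : ℕ) (x : Fin (rank (i + 1)) → MvPolynomial σ K),
    (d i).mulVec x = 0 ↔ ∃ y, (d (i + 1)).mulVec y = x
  /-- minimality: the image of `F_{i+1}` lies in `𝔪 F_i`, where `𝔪` is the ideal of the variables -/
  minimal : ∀ i a b, d i a b ∈ Ideal.span (Set.range (X : σ → MvPolynomial σ K))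

open Classical in
/-- The graded Betti number `β_{i,j}(I)` of a homogeneous ideal `I` of a polynomial ring in
finitely many variables: the number of basis elements of degree `j` in the `i`-th step of the
minimal graded free resolution of `I` (which exists and is unique up to isomorphism). -/
def gradedBetti {σ K : Type*} [Field K] (I : Ideal (MvPolynomial σ K)) (i j : ℕ) : ℕ :=
  if h : Nonempty (MinimalGradedFreeResolution I) then
    (Finset.univ.filter fun a => h.some.deg i a = j).card
  else 0

/-! ## Monomial ideals and Betti splittings -/

/-- `I` is generated by monomials. -/
def IsMonomialIdeal {σ K : Type*} [Field K] (I : Ideal (MvPolynomial σ K)) : Prop :=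
  ∃ A : Set (σ →₀ ℕ), I = Ideal.span ((fun s => monomial s (1 : K)) '' A)

/-- The (exponent vectors of the) minimal monomial generators of a monomial ideal `I`: the
monomials of `I` that are minimal with respect to divisibility. -/
def minimalMonomialGenerators {σ K : Type*} [Field K] (I : Ideal (MvPolynomial σ K)) :
    Set (σ →₀ ℕ) :=
  {s | Minimal (fun t => monomial t (1 : K) ∈ I) s}

/-- `I = I₁ + I₂` is a Betti splitting of monomial ideals. In the Betti number formula
`β_{i,j}(I) = β_{i,j}(I₁) + β_{i,j}(I₂) + β_{i-1,j}(I₁ ∩ I₂)` one has `β_{-1,j} = 0`. -/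
structure IsBettiSplitting {σ K : Type*} [Field K] (I I₁ I₂ : Ideal (MvPolynomial σ K)) :
    Prop where
  isMonomialIdeal : IsMonomialIdeal I
  isMonomialIdeal_left : IsMonomialIdeal I₁
  isMonomialIdeal_right : IsMonomialIdeal I₂
  eq_add : I = I₁ + I₂
  generators_eq : minimalMonomialGenerators I =
    minimalMonomialGenerators I₁ ∪ minimalMonomialGenerators I₂
  generators_disjoint : Disjoint (minimalMonomialGenerators I₁) (minimalMonomialGenerators I₂)
  betti_zero : ∀ j, gradedBetti I 0 j = gradedBetti I₁ 0 j + gradedBetti I₂ 0 j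
  betti_succ : ∀ i j, gradedBetti I (i + 1) j =
    gradedBetti I₁ (i + 1) j + gradedBetti I₂ (i + 1) j + gradedBetti (I₁ ⊓ I₂) i j

/-! ## Matchings and squarefree powers of edge ideals -/

/-- `M` is a `k`-matching of `G`: a set of `k` pairwise disjoint edges. -/
def IsKMatching {V : Type*} (G : SimpleGraph V) (k : ℕ) (M : Finset (Sym2 V)) : Prop :=
  (M : Set (Sym2 V)) ⊆ G.edgeSet ∧ M.card = k ∧
    ∀ e ∈ M, ∀ f ∈ M, e ≠ f → ∀ x, x ∈ e → x ∉ f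

/-- The matching number `ν(G)` of a finite graph: the maximal size of a matching. -/
def matchingNumber {V : Type*} (G : SimpleGraph V) : ℕ :=
  sSup {k | ∃ M, IsKMatching G k M}

open Classical in
/-- The vertex set `V(M)` of a set `M` of edges. -/
def matchingVertices {V : Type*} [Fintype V] (M : Finset (Sym2 V)) : Finset V :=
  Finset.univ.filter fun x => ∃ e ∈ M, x ∈ e

/-- The `k`-th squarefree power `I(G)^{[k]}` of the edge ideal of `G`: the ideal generated by the
monomials `∏_{x ∈ V(M)} x` for the `k`-matchings `M` of `G`. It is the edge ideal for `k = 1`, the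
unit ideal for `k = 0`, and zero for `k > ν(G)`. -/
def squarefreePower (K : Type*) [Field K] {V : Type*} [Fintype V] (G : SimpleGraph V) (k : ℕ) :
    Ideal (MvPolynomial V K) :=
  Ideal.span {f | ∃ M, IsKMatching G k M ∧ f = ∏ x ∈ matchingVertices M, X x}

/-- The induced subgraph of `G` on the complement of `A`, with the vertices of `A` kept as isolated
vertices, so that its squarefree powers are ideals of the polynomial ring on all vertices of `G`. -/
abbrev deleteVertices {V : Type*} (G : SimpleGraph V) (A : Set V) : SimpleGraph V :=
  (G.induce Aᶜ).spanningCoe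

end

/-! Put I₁ = I(G₁)^{[k]}, I₂ = x_v x_w I(G₂)^{[k-1]} and k = n + 1. The exact sequence 0 → I₁ ∩ I₂ →
I₁ ⊕ I₂ → I₁ + I₂ → 0 lets the mapping cone of a lift of the first map to minimal resolutions
resolve I₁ + I₂ (`IsMinimalResolution.cone`). If the lifts of I₁ ∩ I₂ → I₁ and I₁ ∩ I₂ → I₂ vanish
modulo the ideal of the variables, the cone is minimal, and counting its basis elements gives the
Betti formula (`gradedBetti_sup`). Since `gradedBetti` uses a chosen resolution, existence and
uniqueness of graded ranks are proved as well.

The vanishing comes from a criterion on monomials (`IsMinimalResolution.isMinimalMatrix_of_lift`).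
Fix a multidegree α and suppose that some x_p dividing x^α can be set to 1 in all monomials of I
dividing x^α without leaving J. The resulting monomials generate an ideal R ⊆ J with R : x_p = R, so
the resolution of R has no multidegree involving x_p. The part of the resolution of I in
multidegrees ≤ α maps to J through the resolution of R. A nonzero constant entry in multidegree α
would need a basis element for R of multidegree α, which does not exist because α_p ≠ 0. Any two
lifts agree modulo the variables, so every lift vanishes there.

For J = I₁ take p = v, since I₁ does not involve x_v. For J = I₂ the choice depends on the support
of α: a leaf at w other than v and u if there is one, otherwise u, otherwise a vertex of a
k-matching avoiding v, w, u (`exists_forall_edgeMatching_diff`).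

All ideals that occur are described by a condition on supports of monomials, so identities between
them become statements about matchings inside a vertex set. The sum formula says that a matching
edge at v can only be vw; the intersection formula comes from looking at the matching edge at w
(`inter_matching_iff`). -/

noncomputable section

open Matrix

/-! ## Graded matrices over a polynomial ring -/

section GradedMatrices

variable {σ K M A B C : Type*} [Field K] [AddCommMonoid M]

open Classical in
/-- The sum of the terms of `f` whose exponent vector satisfies `P`. -/
def filterTerms (P : (σ →₀ ℕ) → Prop) (f : MvPolynomial σ K) : MvPolynomial σ K :=
  ∑ s ∈ f.support with P s, monomial s (coeff s f)

open Classical in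
theorem coeff_filterTerms (P : (σ →₀ ℕ) → Prop) (f : MvPolynomial σ K) (t : σ →₀ ℕ) :
    coeff t (filterTerms P f) = if P t then coeff t f else 0 := by
  simp only [filterTerms, coeff_sum, coeff_monomial, Finset.sum_ite_eq', Finset.mem_filter,
    mem_support_iff]
  by_cases h : P t <;> by_cases h' : coeff t f = 0 <;> simp [h, h']

/-- The homogeneous component of degree `m` of an element of the free module `⨁ S(-deg a)`. -/
def homogeneousPart (wt : (σ →₀ ℕ) →+ M) (deg : A → M) (m : M) (x : A → MvPolynomial σ K) :
    A → MvPolynomial σ K :=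
  fun a => filterTerms (fun s => wt s + deg a = m) (x a)

/-- `D` is the matrix of a homogeneous map of degree zero `⨁ S(-degB b) → ⨁ S(-degA a)`. -/
def IsGradedMatrix (wt : (σ →₀ ℕ) →+ M) (degA : A → M) (degB : B → M)
    (D : Matrix A B (MvPolynomial σ K)) : Prop :=
  ∀ a b s, coeff s (D a b) ≠ 0 → wt s + degA a = degB b

/-- A graded map commutes with taking homogeneous components. Hence kernels are homogeneous and
solutions of graded linear systems can be made graded. -/
theorem mulVec_homogeneousPart [Fintype B] {wt : (σ →₀ ℕ) →+ M} {degA : A → M} {degB : B → M}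
    {D : Matrix A B (MvPolynomial σ K)} (hD : IsGradedMatrix wt degA degB D) (m : M)
    (x : B → MvPolynomial σ K) :
    D *ᵥ homogeneousPart wt degB m x = homogeneousPart wt degA m (D *ᵥ x) := by
  classical
  funext a
  ext s
  simp only [homogeneousPart, coeff_filterTerms, mulVec, dotProduct, coeff_sum, coeff_mul,
    mul_ite, mul_zero]
  have key : ∀ b, ∀ p ∈ Finset.HasAntidiagonal.antidiagonal s,
      (if wt p.2 + degB b = m then coeff p.1 (D a b) * coeff p.2 (x b) else 0) =
        if wt s + degA a = m then coeff p.1 (D a b) * coeff p.2 (x b) else 0 := by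
    intro b p hp
    by_cases h : coeff p.1 (D a b) = 0
    · simp [h]
    · have : wt p.2 + degB b = wt s + degA a := by
        rw [← hD a b _ h, ← Finset.HasAntidiagonal.mem_antidiagonal.mp hp, map_add]
        abel
      rw [this]
  rw [Finset.sum_congr rfl fun b _ => Finset.sum_congr rfl (key b)]
  split_ifs <;> simp

theorem homogeneousPart_eq_self {wt : (σ →₀ ℕ) →+ M} {deg : A → M} {m : M}
    {x : A → MvPolynomial σ K} (h : ∀ a s, coeff s (x a) ≠ 0 → wt s + deg a = m) :
    homogeneousPart wt deg m x = x := by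
  classical
  funext a
  ext s
  simp only [homogeneousPart, coeff_filterTerms]
  split_ifs with hs
  · rfl
  · by_contra hne
    exact hs (h a s (Ne.symm hne))

theorem homogeneousPart_isHomogeneous {wt : (σ →₀ ℕ) →+ M} {deg : A → M} {m : M}
    {x : A → MvPolynomial σ K} (a : A) (s : σ →₀ ℕ)
    (h : coeff s (homogeneousPart wt deg m x a) ≠ 0) : wt s + deg a = m := by
  classical
  simp only [homogeneousPart, coeff_filterTerms] at h
  exact (ite_ne_right_iff.mp h).1

theorem IsGradedMatrix.mul [Fintype B] {wt : (σ →₀ ℕ) →+ M} {degA : A → M} {degB : B → M}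
    {degC : C → M} {X : Matrix A B (MvPolynomial σ K)} {Y : Matrix B C (MvPolynomial σ K)}
    (hX : IsGradedMatrix wt degA degB X) (hY : IsGradedMatrix wt degB degC Y) :
    IsGradedMatrix wt degA degC (X * Y) := by
  classical
  intro a c s hs
  rw [mul_apply, coeff_sum] at hs
  obtain ⟨b, -, hb⟩ := Finset.exists_ne_zero_of_sum_ne_zero hs
  rw [coeff_mul] at hb
  obtain ⟨p, hp, hp'⟩ := Finset.exists_ne_zero_of_sum_ne_zero hb
  rw [← hY b c _ (right_ne_zero_of_mul hp'), ← hX a b _ (left_ne_zero_of_mul hp'),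
    ← Finset.HasAntidiagonal.mem_antidiagonal.mp hp, map_add]
  abel

theorem IsGradedMatrix.map_weight {N : Type*} [AddCommMonoid N] {wt : (σ →₀ ℕ) →+ M}
    {degA : A → M} {degB : B → M} {X : Matrix A B (MvPolynomial σ K)}
    (hX : IsGradedMatrix wt degA degB X) (f : M →+ N) :
    IsGradedMatrix (f.comp wt) (f ∘ degA) (f ∘ degB) X := by
  intro a b s hs
  simp [← hX a b s hs]

/-- If the columns of a graded matrix `Y` lie in the range of the graded matrix `X`, then `Y`
factors through `X` by a graded matrix. -/
theorem IsGradedMatrix.exists_mul_eq [Fintype B] {wt : (σ →₀ ℕ) →+ M} {degA : A → M}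
    {degB : B → M} {degC : C → M} {X : Matrix A B (MvPolynomial σ K)}
    {Y : Matrix A C (MvPolynomial σ K)} (hX : IsGradedMatrix wt degA degB X)
    (hY : IsGradedMatrix wt degA degC Y) (h : ∀ c, ∃ y, X *ᵥ y = fun a => Y a c) :
    ∃ Z : Matrix B C (MvPolynomial σ K), X * Z = Y ∧ IsGradedMatrix wt degB degC Z := by
  choose y hy using h
  refine ⟨fun b c => homogeneousPart wt degB (degC c) (y c) b, ?_, fun b c s hs =>
    homogeneousPart_isHomogeneous b s hs⟩
  ext1 a c
  have := congrFun (mulVec_homogeneousPart hX (degC c) (y c)) a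
  rw [hy, homogeneousPart_eq_self (fun a s => hY a c s)] at this
  exact this

/-- The nongraded version of `IsGradedMatrix.exists_mul_eq`. -/
theorem exists_mul_eq_of_forall_col [Fintype B] {X : Matrix A B (MvPolynomial σ K)}
    {Y : Matrix A C (MvPolynomial σ K)} (h : ∀ c, ∃ y, X *ᵥ y = fun a => Y a c) :
    ∃ Z : Matrix B C (MvPolynomial σ K), X * Z = Y := by
  choose y hy using h
  exact ⟨fun b c => y c b, by ext1 a c; exact congrFun (hy c) a⟩

/-- All entries of `X` have constant coefficient zero. -/
def IsMinimalMatrix (X : Matrix A B (MvPolynomial σ K)) : Prop :=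
  ∀ a b, constantCoeff (X a b) = 0

theorem IsMinimalMatrix.mulVec [Fintype B] {X : Matrix A B (MvPolynomial σ K)}
    (hX : IsMinimalMatrix X) (y : B → MvPolynomial σ K) (a : A) :
    constantCoeff ((X *ᵥ y) a) = 0 := by
  simp [Matrix.mulVec, dotProduct, hX a _]

theorem IsMinimalMatrix.mul_left [Fintype B] {X : Matrix A B (MvPolynomial σ K)}
    (hX : IsMinimalMatrix X) (Y : Matrix B C (MvPolynomial σ K)) : IsMinimalMatrix (X * Y) := by
  intro a c
  simp [mul_apply, hX a _]

theorem IsMinimalMatrix.mul_right [Fintype B] (X : Matrix A B (MvPolynomial σ K))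
    {Y : Matrix B C (MvPolynomial σ K)} (hY : IsMinimalMatrix Y) : IsMinimalMatrix (X * Y) := by
  intro a c
  simp [mul_apply, hY _ c]

theorem IsMinimalMatrix.add {X Y : Matrix A B (MvPolynomial σ K)}
    (hX : IsMinimalMatrix X) (hY : IsMinimalMatrix Y) : IsMinimalMatrix (X + Y) := by
  intro a b
  simp [hX a b, hY a b]

end GradedMatrices

/-! ## Comparison of complexes -/

theorem exists_dependent_seq {α : ℕ → Type*} {r : ∀ i, α i → α (i + 1) → Prop}
    (h : ∀ i a, ∃ b, r i a b) (a₀ : α 0) :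
    ∃ f : ∀ i, α i, f 0 = a₀ ∧ ∀ i, r i (f i) (f (i + 1)) := by
  choose g hg using h
  exact ⟨fun i => Nat.rec a₀ g i, rfl, fun i => hg i _⟩

section Comparison

variable {σ K M : Type*} [Field K] [AddCommMonoid M]

/-- The sequence of matrices `D` describes an exact complex in all positions but the last one. -/
def IsExactSeq {C : ℕ → Type*} [∀ i, Fintype (C i)]
    (D : ∀ i, Matrix (C i) (C (i + 1)) (MvPolynomial σ K)) : Prop :=
  ∀ i x, D i *ᵥ x = 0 ↔ ∃ y, D (i + 1) *ᵥ y = x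

variable {C C' : ℕ → Type*} [∀ i, Fintype (C i)] [∀ i, Fintype (C' i)]
  {D : ∀ i, Matrix (C i) (C (i + 1)) (MvPolynomial σ K)}
  {D' : ∀ i, Matrix (C' i) (C' (i + 1)) (MvPolynomial σ K)}

theorem IsExactSeq.mul_eq_zero (h : IsExactSeq D) (i : ℕ) : D i * D (i + 1) = 0 := by
  classical
  refine ext_of_mulVec_single fun b => ?_
  rw [← mulVec_mulVec, zero_mulVec]
  exact (h i _).2 ⟨_, rfl⟩

theorem IsExactSeq.exists_mul_eq {B : Type*} (h : IsExactSeq D) {i : ℕ}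
    {Y : Matrix (C (i + 1)) B (MvPolynomial σ K)} (hY : D i * Y = 0) :
    ∃ Z : Matrix (C (i + 1 + 1)) B (MvPolynomial σ K), D (i + 1) * Z = Y :=
  exists_mul_eq_of_forall_col fun c => (h i _).1 (by
    funext a
    exact congrFun (congrFun hY a) c)

/-- A graded map in position zero lifts to a graded map from a complex of free modules to an exact
complex. -/
theorem exists_graded_lift {wt : (σ →₀ ℕ) →+ M} {deg : ∀ i, C i → M} {deg' : ∀ i, C' i → M}
    (hD : ∀ i, IsGradedMatrix wt (deg i) (deg (i + 1)) (D i))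
    (hD' : ∀ i, IsGradedMatrix wt (deg' i) (deg' (i + 1)) (D' i))
    (hDD : ∀ i, D i * D (i + 1) = 0) (hex : IsExactSeq D')
    (φ₀ : Matrix (C' 0) (C 0) (MvPolynomial σ K)) (hφ₀ : IsGradedMatrix wt (deg' 0) (deg 0) φ₀)
    (h₀ : ∀ x, ∃ y, D' 0 *ᵥ y = (φ₀ * D 0) *ᵥ x) :
    ∃ φ : ∀ i, Matrix (C' i) (C i) (MvPolynomial σ K), φ 0 = φ₀ ∧
      (∀ i, D' i * φ (i + 1) = φ i * D i) ∧ ∀ i, IsGradedMatrix wt (deg' i) (deg i) (φ i) := by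
  classical
  let α : ℕ → Type _ := fun i => {φ : Matrix (C' i) (C i) (MvPolynomial σ K) //
    IsGradedMatrix wt (deg' i) (deg i) φ ∧ ∀ x, ∃ y, D' i *ᵥ y = (φ * D i) *ᵥ x}
  obtain ⟨f, hf₀, hf⟩ := exists_dependent_seq (α := α)
    (r := fun i φ ψ => D' i * ψ.1 = φ.1 * D i) (fun i φ => by
      obtain ⟨Z, hZ, hZg⟩ := (hD' i).exists_mul_eq (φ.2.1.mul (hD i)) (fun c => by
        obtain ⟨y, hy⟩ := φ.2.2 (Pi.single c 1)
        exact ⟨y, by rw [hy, mulVec_single_one]; rfl⟩)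
      refine ⟨⟨Z, hZg, fun x => ?_⟩, hZ⟩
      refine (hex i _).1 ?_
      rw [mulVec_mulVec, ← Matrix.mul_assoc, hZ, Matrix.mul_assoc, hDD, Matrix.mul_zero,
        zero_mulVec]) ⟨φ₀, hφ₀, h₀⟩
  exact ⟨fun i => (f i).1, congrArg Subtype.val hf₀, hf, fun i => (f i).2.1⟩

/-- Two lifts of the same map to minimal complexes agree modulo the ideal of the variables. -/
theorem isMinimalMatrix_sub_of_lifts (hDD : ∀ i, D i * D (i + 1) = 0) (hex : IsExactSeq D')
    (hmin : ∀ i, IsMinimalMatrix (D (i + 1))) (hmin' : ∀ i, IsMinimalMatrix (D' (i + 1)))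
    {φ ψ : ∀ i, Matrix (C' i) (C i) (MvPolynomial σ K)}
    (hφ : ∀ i, D' i * φ (i + 1) = φ i * D i) (hψ : ∀ i, D' i * ψ (i + 1) = ψ i * D i)
    (h₀ : φ 0 = ψ 0) (i : ℕ) : IsMinimalMatrix (φ (i + 1) - ψ (i + 1)) := by
  have step : ∀ i (s : Matrix (C' (i + 1)) (C i) (MvPolynomial σ K)),
      D' i * s * D i = (φ i - ψ i) * D i →
      ∃ t : Matrix (C' (i + 1 + 1)) (C (i + 1)) (MvPolynomial σ K),
        D' (i + 1) * t = φ (i + 1) - ψ (i + 1) - s * D i := fun i s hs =>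
    hex.exists_mul_eq (by
      rw [Matrix.mul_sub, Matrix.mul_sub, hφ, hψ, ← Matrix.mul_assoc, hs, Matrix.sub_mul, sub_self])
  -- This is the homotopy identity composed with `D i`, which kills the term coming from the
  -- previous homotopy. Minimality of `s * D i` is carried along because `D 0` need not be minimal;
  -- in position zero the homotopy is 0.
  have key : ∀ i, ∃ s : Matrix (C' (i + 1)) (C i) (MvPolynomial σ K),
      D' i * s * D i = (φ i - ψ i) * D i ∧ IsMinimalMatrix (s * D i) := by
    intro i
    induction i with
    | zero => exact ⟨0, by simp [h₀], fun a b => by simp⟩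
    | succ i ih =>
      obtain ⟨s, hs, -⟩ := ih
      obtain ⟨t, ht⟩ := step i s hs
      refine ⟨t, ?_, (hmin i).mul_right t⟩
      rw [ht, Matrix.sub_mul _ (s * D i), Matrix.mul_assoc s, hDD, Matrix.mul_zero, sub_zero]
  obtain ⟨s, hs, hsmin⟩ := key i
  obtain ⟨t, ht⟩ := step i s hs
  have := ((hmin' i).mul_left t).add hsmin
  rwa [ht, sub_add_cancel] at this

end Comparison

/-! ## Minimal graded resolutions -/

/-- The matrices `D` form a minimal graded free resolution of the ideal `I`, augmented by the
inclusion of `I` into the polynomial ring, which is the free module of rank one in position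
zero. -/
structure IsMinimalResolution {σ K M : Type*} [Field K] [AddCommMonoid M] {C : ℕ → Type*}
    [∀ i, Fintype (C i)] (wt : (σ →₀ ℕ) →+ M) (deg : ∀ i, C i → M)
    (D : ∀ i, Matrix (C i) (C (i + 1)) (MvPolynomial σ K)) (I : Ideal (MvPolynomial σ K)) :
    Prop where
  subsingleton : Subsingleton (C 0)
  nonempty : Nonempty (C 0)
  deg_zero : ∀ a, deg 0 a = 0
  graded : ∀ i, IsGradedMatrix wt (deg i) (deg (i + 1)) (D i)
  exact : IsExactSeq D
  minimal : ∀ i, IsMinimalMatrix (D (i + 1))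
  mem_iff : ∀ f, f ∈ I ↔ ∃ y, D 0 *ᵥ y = fun _ => f

section Resolutions

variable {σ K M : Type*} [Field K] [AddCommMonoid M] {C C' : ℕ → Type*} [∀ i, Fintype (C i)]
  [∀ i, Fintype (C' i)] {wt : (σ →₀ ℕ) →+ M} {deg : ∀ i, C i → M} {deg' : ∀ i, C' i → M}
  {D : ∀ i, Matrix (C i) (C (i + 1)) (MvPolynomial σ K)}
  {D' : ∀ i, Matrix (C' i) (C' (i + 1)) (MvPolynomial σ K)} {I J : Ideal (MvPolynomial σ K)}

theorem IsMinimalResolution.mulVec_mem (h : IsMinimalResolution wt deg D I)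
    (x : C 1 → MvPolynomial σ K) (a : C 0) : (D 0 *ᵥ x) a ∈ I :=
  (h.mem_iff _).2 ⟨x, funext fun b => by rw [h.subsingleton.elim b a]⟩

theorem IsMinimalResolution.entry_mem (h : IsMinimalResolution wt deg D I) (a : C 0) (b : C 1) :
    D 0 a b ∈ I := by
  classical
  have := h.mulVec_mem (Pi.single b 1) a
  rwa [mulVec_single_one] at this

theorem IsMinimalResolution.map_weight {N : Type*} [AddCommMonoid N]
    (h : IsMinimalResolution wt deg D I) (f : M →+ N) :
    IsMinimalResolution (f.comp wt) (fun i => f ∘ deg i) D I where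
  subsingleton := h.subsingleton
  nonempty := h.nonempty
  deg_zero a := by simp [h.deg_zero a]
  graded i := (h.graded i).map_weight f
  exact := h.exact
  minimal := h.minimal
  mem_iff := h.mem_iff

/-- Forgetting the grading allows comparison of resolutions graded by different monoids. -/
theorem IsMinimalResolution.ungraded (h : IsMinimalResolution wt deg D I) :
    IsMinimalResolution (0 : (σ →₀ ℕ) →+ ℕ) (fun _ _ => 0) D I where
  subsingleton := h.subsingleton
  nonempty := h.nonempty
  deg_zero _ := rfl
  graded _ _ _ _ _ := rfl
  exact := h.exact
  minimal := h.minimal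
  mem_iff := h.mem_iff

/-- A graded complex of free modules with augmentation into `J` maps to a resolution of `J`. -/
theorem IsMinimalResolution.exists_lift (h' : IsMinimalResolution wt deg' D' J)
    (hD : ∀ i, IsGradedMatrix wt (deg i) (deg (i + 1)) (D i)) (hDD : ∀ i, D i * D (i + 1) = 0)
    (hdeg : ∀ a, deg 0 a = 0) (hDJ : ∀ a b, D 0 a b ∈ J) :
    ∃ φ : ∀ i, Matrix (C' i) (C i) (MvPolynomial σ K), φ 0 = of (fun _ _ => 1) ∧
      (∀ i, D' i * φ (i + 1) = φ i * D i) ∧ ∀ i, IsGradedMatrix wt (deg' i) (deg i) (φ i) := by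
  classical
  refine exists_graded_lift hD h'.graded hDD h'.exact _ (fun a b s hs => ?_) (fun x => ?_)
  · have : s = 0 := by
      by_contra hne
      exact hs (by rw [of_apply, coeff_one, if_neg (Ne.symm hne)])
    simp [this, hdeg, h'.deg_zero]
  · obtain ⟨y, hy⟩ := (h'.mem_iff (∑ b, (∑ a, D 0 a b) * x b)).1
      (sum_mem fun b _ => Ideal.mul_mem_right _ _ (sum_mem fun a _ => hDJ a b))
    refine ⟨y, ?_⟩
    rw [hy]
    funext a
    simp [mulVec, dotProduct, mul_apply]

theorem IsMinimalResolution.exists_comparison (h : IsMinimalResolution wt deg D I)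
    (h' : IsMinimalResolution wt deg' D' J) (hIJ : I ≤ J) :
    ∃ φ : ∀ i, Matrix (C' i) (C i) (MvPolynomial σ K), φ 0 = of (fun _ _ => 1) ∧
      (∀ i, D' i * φ (i + 1) = φ i * D i) ∧ ∀ i, IsGradedMatrix wt (deg' i) (deg i) (φ i) :=
  h'.exists_lift h.graded h.exact.mul_eq_zero h.deg_zero
    fun a b => hIJ (h.entry_mem a b)

/-- `ψ ∘ φ` and the identity both lift the identity of position zero, so they agree modulo the
variables. -/
theorem map_constantCoeff_mul_eq_one_of_lifts [∀ i, DecidableEq (C i)]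
    (h : IsMinimalResolution wt deg D I)
    {φ : ∀ i, Matrix (C' i) (C i) (MvPolynomial σ K)}
    {ψ : ∀ i, Matrix (C i) (C' i) (MvPolynomial σ K)}
    (h'ne : Nonempty (C' 0)) (h'ss : Subsingleton (C' 0))
    (hφ₀ : φ 0 = of fun _ _ => 1) (hψ₀ : ψ 0 = of fun _ _ => 1)
    (hφ : ∀ i, D' i * φ (i + 1) = φ i * D i) (hψ : ∀ i, D i * ψ (i + 1) = ψ i * D' i) (i : ℕ) :
    (ψ (i + 1)).map constantCoeff * (φ (i + 1)).map constantCoeff = 1 := by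
  have hmin := isMinimalMatrix_sub_of_lifts h.exact.mul_eq_zero h.exact h.minimal h.minimal
    (φ := fun i => ψ i * φ i) (ψ := fun i => 1)
    (fun i => by rw [← Matrix.mul_assoc, hψ, Matrix.mul_assoc, hφ, Matrix.mul_assoc])
    (fun i => by simp) (by
      obtain ⟨c⟩ := h'ne
      have := h.subsingleton
      have : Unique (C' 0) := ⟨⟨c⟩, fun _ => Subsingleton.elim _ _⟩
      ext1 a b
      rw [hφ₀, hψ₀, mul_apply, Subsingleton.elim a b]
      simp) i
  ext a b
  have := hmin a b
  rw [Matrix.sub_apply, map_sub, sub_eq_zero] at this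
  rw [← Matrix.map_mul, map_apply, this, one_apply, one_apply]
  split_ifs <;> simp

/-- A nonzero constant entry of a graded matrix joins basis elements of equal degree. Reduction
modulo the variables is therefore block diagonal, and one-sided inverses restrict to each degree. -/
theorem submatrix_mul_submatrix_eq_one {A B : Type*} [Fintype B] [DecidableEq A]
    [DecidableEq M] {dA : A → M} {dB : B → M} {P : Matrix A B (MvPolynomial σ K)}
    {Q : Matrix B A (MvPolynomial σ K)} (hP : IsGradedMatrix wt dA dB P) [Fintype A]
    (hPQ : P.map constantCoeff * Q.map constantCoeff = 1) (j : M) :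
    (P.map constantCoeff).submatrix (fun a : {a // dA a = j} => a.1)
        (fun b : {b // dB b = j} => b.1) *
      (Q.map constantCoeff).submatrix (fun b : {b // dB b = j} => b.1)
        (fun a : {a // dA a = j} => a.1) = 1 := by
  ext a c
  have := congrFun (congrFun hPQ a.1) c.1
  rw [mul_apply] at this ⊢
  simp only [submatrix_apply]
  rw [one_apply] at this ⊢
  simp only [Subtype.ext_iff]
  rw [← this, ← Finset.sum_subtype (Finset.univ.filter fun b => dB b = j) (by simp)
    (fun b => P.map constantCoeff a.1 b * Q.map constantCoeff b c.1)]
  refine Finset.sum_subset (Finset.subset_univ _) fun b _ hb => ?_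
  have : constantCoeff (P a.1 b) = 0 := by
    by_contra hne
    have := hP a.1 b 0 hne
    simp [a.2] at this
    simp [this] at hb
  simp [this]

/-- The graded ranks of a minimal graded free resolution depend only on the ideal. -/
theorem IsMinimalResolution.card_deg_eq [DecidableEq M] (h : IsMinimalResolution wt deg D I)
    (h' : IsMinimalResolution wt deg' D' I) (i : ℕ) (j : M) :
    Fintype.card {a : C (i + 1) // deg (i + 1) a = j} =
      Fintype.card {a : C' (i + 1) // deg' (i + 1) a = j} := by
  classical
  obtain ⟨φ, hφ₀, hφ, hφg⟩ := h.exists_comparison h' le_rfl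
  obtain ⟨ψ, hψ₀, hψ, hψg⟩ := h'.exists_comparison h le_rfl
  have h1 := map_constantCoeff_mul_eq_one_of_lifts h h'.nonempty h'.subsingleton hφ₀ hψ₀ hφ hψ i
  have h2 := map_constantCoeff_mul_eq_one_of_lifts h' h.nonempty h.subsingleton hψ₀ hφ₀ hψ hφ i
  exact square_of_invertible _ _ (submatrix_mul_submatrix_eq_one (hψg _) h1 j)
    (submatrix_mul_submatrix_eq_one (hφg _) h2 j)

end Resolutions

/-! ## Existence of minimal graded resolutions -/

section Existence

variable {σ K M A : Type*} [Field K]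

/-- Closure of a submodule of `⨁ S(-deg a)` under taking homogeneous components. -/
def IsHomogeneousSubmodule [AddCommMonoid M] (wt : (σ →₀ ℕ) →+ M) (deg : A → M)
    (N : Submodule (MvPolynomial σ K) (A → MvPolynomial σ K)) : Prop :=
  ∀ x ∈ N, ∀ m, homogeneousPart wt deg m x ∈ N

theorem sum_homogeneousPart [Fintype A] [AddCommMonoid M] (wt : (σ →₀ ℕ) →+ M) (deg : A → M)
    (x : A → MvPolynomial σ K) : ∃ T : Finset M, ∑ m ∈ T, homogeneousPart wt deg m x = x := by
  classical
  refine ⟨Finset.univ.biUnion fun a => (x a).support.image fun s => wt s + deg a, ?_⟩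
  funext a
  ext s
  simp only [Finset.sum_apply, coeff_sum, homogeneousPart, coeff_filterTerms]
  rw [Finset.sum_ite_eq]
  split_ifs with h
  · rfl
  · by_contra hne
    refine h ?_
    simp only [Finset.mem_biUnion, Finset.mem_univ, true_and, Finset.mem_image]
    exact ⟨a, s, mem_support_iff.2 (Ne.symm hne), rfl⟩

theorem IsHomogeneousSubmodule.exists_generators [Finite σ] [Fintype A] [AddCommMonoid M]
    {wt : (σ →₀ ℕ) →+ M} {deg : A → M}
    {N : Submodule (MvPolynomial σ K) (A → MvPolynomial σ K)}
    (hN : IsHomogeneousSubmodule wt deg N) :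
    ∃ (n : ℕ) (g : Fin n → A → MvPolynomial σ K),
      (∀ b, ∃ m, ∀ a s, coeff s (g b a) ≠ 0 → wt s + deg a = m) ∧
      Submodule.span _ (Set.range g) = N := by
  have hspan : Submodule.span (MvPolynomial σ K)
      {x | x ∈ N ∧ ∃ m, ∀ a s, coeff s (x a) ≠ 0 → wt s + deg a = m} = N := by
    refine le_antisymm (Submodule.span_le.2 fun x hx => hx.1) fun x hx => ?_
    obtain ⟨T, hT⟩ := sum_homogeneousPart wt deg x
    rw [← hT]
    exact sum_mem fun m _ => Submodule.subset_span
      ⟨hN x hx m, m, fun a s => homogeneousPart_isHomogeneous a s⟩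
  have hfg : (Submodule.span (MvPolynomial σ K)
      {x | x ∈ N ∧ ∃ m, ∀ a s, coeff s (x a) ≠ 0 → wt s + deg a = m}).FG :=
    IsNoetherian.noetherian _
  obtain ⟨T, hT, hTs⟩ := (Submodule.fg_span_iff_fg_span_finset_subset _).1 hfg
  refine ⟨T.card, fun b => (T.equivFin.symm b).1, fun b => (hT (T.equivFin.symm b).2).2, ?_⟩
  rw [← hspan, hTs]
  congr 1
  ext x
  constructor
  · rintro ⟨b, rfl⟩
    exact (T.equivFin.symm b).2
  · intro hx
    exact ⟨T.equivFin ⟨x, hx⟩, by simp⟩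

/-- A homogeneous submodule of a graded free module has a minimal system of homogeneous
generators. -/
theorem IsHomogeneousSubmodule.exists_minimal_matrix [Finite σ] [Fintype A]
    [AddCommMonoid M] [IsCancelAdd M] {wt : (σ →₀ ℕ) →+ M} (hwt : ∀ s, wt s = 0 → s = 0)
    {deg : A → M}
    {N : Submodule (MvPolynomial σ K) (A → MvPolynomial σ K)}
    (hN : IsHomogeneousSubmodule wt deg N) :
    ∃ (n : ℕ) (degB : Fin n → M) (D : Matrix A (Fin n) (MvPolynomial σ K)),
      IsGradedMatrix wt deg degB D ∧ (∀ x, x ∈ N ↔ ∃ y, D *ᵥ y = x) ∧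
      ∀ y, D *ᵥ y = 0 → ∀ b, constantCoeff (y b) = 0 := by
  classical
  -- The number of homogeneous generators is taken least possible; a relation with a nonzero
  -- constant coefficient would make one of them redundant.
  have hex := hN.exists_generators
  obtain ⟨g, hg, hspan⟩ := Nat.find_spec hex
  have hmin := fun m => Nat.find_min hex (m := m)
  generalize Nat.find hex = n at g hg hspan hmin
  choose degB hdegB using hg
  have hmulVec : ∀ y, (of fun a b => g b a) *ᵥ y = ∑ b, y b • g b := by
    intro y
    funext a
    simp [mulVec, dotProduct, Finset.sum_apply, mul_comm]
  have hgr : IsGradedMatrix wt deg degB (of fun a b => g b a) := fun a b s => hdegB b a s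
  refine ⟨n, degB, of fun a b => g b a, hgr, fun x => ?_, fun y hy b => ?_⟩
  · rw [← hspan, Submodule.mem_span_range_iff_exists_fun]
    simp only [hmulVec]
  · by_contra hne
    obtain ⟨n, rfl⟩ : ∃ n', n = n' + 1 := ⟨n - 1, by have := b.2; omega⟩
    refine hmin n (Nat.lt_succ_self n) ⟨fun i => g (b.succAbove i), fun i => ⟨_, hdegB _⟩, ?_⟩
    set y' := homogeneousPart wt degB (degB b) y with hy'
    have hrel : ∑ i, y' i • g i = 0 := by
      rw [← hmulVec, hy', mulVec_homogeneousPart hgr, hy]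
      funext a
      ext s
      simp [homogeneousPart, coeff_filterTerms]
    -- In the component of degree `degB b` the coefficient of `g b` has weight 0, so it is a
    -- constant by `hwt`.
    have hunit : y' b = C (constantCoeff (y b)) := by
      ext s
      simp only [hy', homogeneousPart, coeff_filterTerms, coeff_C, add_eq_right]
      by_cases hs : s = 0
      · subst hs
        simp [constantCoeff_eq]
      · rw [if_neg (fun h => hs (hwt s h)), if_neg (Ne.symm hs)]
    rw [Fin.sum_univ_succAbove _ b, hunit] at hrel
    have hb : g b ∈ Submodule.span (MvPolynomial σ K) (Set.range fun i => g (b.succAbove i)) := by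
      have h1 : (C (constantCoeff (y b)) : MvPolynomial σ K) • g b ∈
          Submodule.span (MvPolynomial σ K) (Set.range fun i => g (b.succAbove i)) := by
        rw [eq_neg_of_add_eq_zero_left hrel]
        exact neg_mem (sum_mem fun i _ => Submodule.smul_mem _ _ (Submodule.subset_span ⟨i, rfl⟩))
      have h2 := Submodule.smul_mem _ (C (constantCoeff (y b))⁻¹ : MvPolynomial σ K) h1
      rwa [smul_smul, ← C_mul, inv_mul_cancel₀ hne, C_1, one_smul] at h2
    rw [← hspan]
    refine le_antisymm (Submodule.span_mono ?_) (Submodule.span_le.2 ?_)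
    · rintro _ ⟨i, rfl⟩
      exact ⟨_, rfl⟩
    · rintro _ ⟨i, rfl⟩
      rcases Fin.eq_self_or_eq_succAbove b i with rfl | ⟨j, rfl⟩
      · exact hb
      · exact Submodule.subset_span ⟨j, rfl⟩

/-- A homogeneous submodule of a graded free module of finite rank. -/
structure GradedFreeSubmodule (K : Type*) [Field K] [AddCommMonoid M]
    (wt : (σ →₀ ℕ) →+ M) where
  rank : ℕ
  deg : Fin rank → M
  submodule : Submodule (MvPolynomial σ K) (Fin rank → MvPolynomial σ K)
  isHomogeneous : IsHomogeneousSubmodule wt deg submodule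

/-- An ideal as a submodule of the free module of rank one. -/
def Ideal.toSubmoduleFun (I : Ideal (MvPolynomial σ K)) :
    Submodule (MvPolynomial σ K) (Fin 1 → MvPolynomial σ K) :=
  Submodule.comap (LinearMap.proj 0) I

/-- A homogeneous ideal has a minimal graded free resolution. -/
theorem exists_isMinimalResolution [Finite σ] [AddCommMonoid M] [IsCancelAdd M] {wt : (σ →₀ ℕ) →+ M}
    (hwt : ∀ s, wt s = 0 → s = 0) {I : Ideal (MvPolynomial σ K)}
    (hI : IsHomogeneousSubmodule wt (fun _ => 0) I.toSubmoduleFun) :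
    ∃ (n : ℕ → ℕ) (deg : ∀ i, Fin (n i) → M)
      (D : ∀ i, Matrix (Fin (n i)) (Fin (n (i + 1))) (MvPolynomial σ K)),
      IsMinimalResolution wt deg D I := by
  obtain ⟨f, hf₀, hf⟩ := exists_dependent_seq (α := fun _ => GradedFreeSubmodule K wt)
    (r := fun _ N N' => ∃ D : Matrix (Fin N.rank) (Fin N'.rank) (MvPolynomial σ K),
      IsGradedMatrix wt N.deg N'.deg D ∧ (∀ x, x ∈ N.submodule ↔ ∃ y, D *ᵥ y = x) ∧
      (∀ y, y ∈ N'.submodule ↔ D *ᵥ y = 0) ∧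
      ∀ y, D *ᵥ y = 0 → ∀ b, constantCoeff (y b) = 0)
    (fun _ N => by
      obtain ⟨n, degB, D, hD, hx, hmin⟩ := N.isHomogeneous.exists_minimal_matrix hwt
      refine ⟨⟨n, degB, LinearMap.ker D.mulVecLin, fun x hx m => ?_⟩, D, hD, hx, fun y => ?_, hmin⟩
      · rw [LinearMap.mem_ker, mulVecLin_apply] at hx ⊢
        classical
        rw [mulVec_homogeneousPart hD, hx]
        funext a
        ext s
        simp [homogeneousPart, coeff_filterTerms]
      · rw [LinearMap.mem_ker, mulVecLin_apply])
    ⟨1, fun _ => 0, I.toSubmoduleFun, hI⟩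
  choose D hD hmem hker hmin using hf
  refine ⟨fun i => (f i).rank, fun i => (f i).deg, D, ?_, ?_, ?_, hD, ?_, ?_, ?_⟩
  · change Subsingleton (Fin (f 0).rank)
    rw [hf₀]
    infer_instance
  · change Nonempty (Fin (f 0).rank)
    rw [hf₀]
    infer_instance
  · change ∀ a, (f 0).deg a = 0
    rw [hf₀]
    simp
  · intro i x
    rw [← hker, hmem]
  · classical
    intro i a b
    have := hmin i (D (i + 1) *ᵥ Pi.single b 1) ((hker i _).1 ((hmem (i + 1) _).2 ⟨_, rfl⟩)) a
    rwa [mulVec_single_one] at this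
  · intro x
    have : x ∈ I ↔ (fun _ => x) ∈ (f 0).submodule := by
      rw [hf₀]
      rfl
    rw [this, hmem]

end Existence

/-! ## Multigraded resolutions of monomial ideals -/

section Monomial

variable {σ K : Type*} [Field K] {I J : Ideal (MvPolynomial σ K)}

theorem IsMonomialIdeal.monomial_mem (hI : IsMonomialIdeal I) {f : MvPolynomial σ K} (hf : f ∈ I)
    {s : σ →₀ ℕ} (hs : coeff s f ≠ 0) : monomial s (1 : K) ∈ I := by
  obtain ⟨A, rfl⟩ := hI
  obtain ⟨t, ht, hts⟩ := mem_ideal_span_monomial_image.1 hf s (mem_support_iff.2 hs)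
  refine mem_ideal_span_monomial_image.2 fun r hr => ⟨t, ht, ?_⟩
  rwa [Finset.mem_singleton.1 (support_monomial_subset hr)]

theorem Ideal.mem_of_forall_monomial_mem {f : MvPolynomial σ K}
    (h : ∀ s, coeff s f ≠ 0 → monomial s (1 : K) ∈ I) : f ∈ I := by
  rw [f.as_sum]
  refine Submodule.sum_mem I fun s hs => ?_
  have := I.mul_mem_left (C (coeff s f)) (h s (mem_support_iff.1 hs))
  rwa [C_mul_monomial, mul_one] at this

theorem monomial_mem_of_le {s t : σ →₀ ℕ} (hst : s ≤ t) (hs : monomial s (1 : K) ∈ I) :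
    monomial t (1 : K) ∈ I := by
  have := I.mul_mem_left (monomial (t - s) (1 : K)) hs
  rwa [monomial_mul, one_mul, tsub_add_cancel_of_le hst] at this

theorem IsMonomialIdeal.isHomogeneousSubmodule (hI : IsMonomialIdeal I) :
    IsHomogeneousSubmodule (AddMonoidHom.id (σ →₀ ℕ)) (fun _ => 0) I.toSubmoduleFun := by
  classical
  intro x hx m
  refine Ideal.mem_of_forall_monomial_mem fun s hs => hI.monomial_mem hx (s := s) ?_
  simp only [homogeneousPart, LinearMap.proj_apply, coeff_filterTerms] at hs
  exact fun h => hs (by rw [LinearMap.proj_apply] at h; rw [h, ite_self])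

/-- A monomial ideal has a minimal multigraded free resolution. -/
theorem IsMonomialIdeal.exists_isMinimalResolution [Finite σ] (hI : IsMonomialIdeal I) :
    ∃ (n : ℕ → ℕ) (deg : ∀ i, Fin (n i) → σ →₀ ℕ)
      (D : ∀ i, Matrix (Fin (n i)) (Fin (n (i + 1))) (MvPolynomial σ K)),
      IsMinimalResolution (AddMonoidHom.id (σ →₀ ℕ)) deg D I :=
  _root_.exists_isMinimalResolution (fun s hs => by rwa [AddMonoidHom.id_apply] at hs)
    hI.isHomogeneousSubmodule

variable {C C' : ℕ → Type*} [∀ i, Fintype (C i)] [∀ i, Fintype (C' i)]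
  {deg : ∀ i, C i → σ →₀ ℕ} {D : ∀ i, Matrix (C i) (C (i + 1)) (MvPolynomial σ K)}
  {D' : ∀ i, Matrix (C' i) (C' (i + 1)) (MvPolynomial σ K)}

theorem IsMinimalResolution.constantCoeff_eq_zero {M : Type*} [AddCommMonoid M]
    {wt : (σ →₀ ℕ) →+ M} {deg : ∀ i, C i → M} (h : IsMinimalResolution wt deg D I) {i : ℕ}
    {x : C (i + 1) → MvPolynomial σ K} (hx : D i *ᵥ x = 0) (b : C (i + 1)) :
    constantCoeff (x b) = 0 := by
  obtain ⟨y, rfl⟩ := (h.exact i x).1 hx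
  exact (h.minimal i).mulVec y b

/-- If `I : x_p = I`, then the multidegrees in the minimal multigraded resolution of `I` do not
involve `x_p`. -/
theorem IsMinimalResolution.deg_apply_eq_zero
    (h : IsMinimalResolution (AddMonoidHom.id (σ →₀ ℕ)) deg D I) {p : σ}
    (hp : ∀ f, X p * f ∈ I → f ∈ I) (i : ℕ) (b : C i) : deg i b p = 0 := by
  classical
  induction i with
  | zero => simp [h.deg_zero]
  | succ i ih =>
    by_contra hne
    -- By induction the row degrees do not involve `p`, so each monomial of the column carries the
    -- full, nonzero exponent of `x_p` in its degree.
    have hdvd : ∀ a, ∃ f, D i a b = X p * f := by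
      intro a
      have : D i a b ∈ Ideal.span ((X : σ → MvPolynomial σ K) '' {p}) := by
        refine mem_ideal_span_X_image.2 fun s hs => ⟨p, rfl, ?_⟩
        have := DFunLike.congr_fun (h.graded i a b s (mem_support_iff.1 hs)) p
        simp only [AddMonoidHom.id_apply, Finsupp.add_apply, ih a] at this
        omega
      rw [Set.image_singleton] at this
      exact Ideal.mem_span_singleton.1 this
    choose f hf using hdvd
    have hX : D i *ᵥ Pi.single b 1 = (X p : MvPolynomial σ K) • f := by
      rw [mulVec_single_one]
      exact funext hf
    -- The column divided by `x_p` is still in the image: by the colon hypothesis in position zero,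
    -- by torsion-freeness afterwards.
    have hy : ∃ y, D i *ᵥ y = f := by
      cases i with
      | zero =>
        have := h.subsingleton
        obtain ⟨a⟩ := h.nonempty
        obtain ⟨y, hy⟩ := (h.mem_iff (f a)).1 (hp _ (by rw [← hf]; exact h.entry_mem a b))
        exact ⟨y, by rw [hy]; funext a'; rw [Subsingleton.elim a a']⟩
      | succ i =>
        refine (h.exact i f).1 ?_
        have h0 : (X p : MvPolynomial σ K) • (D i *ᵥ f) = 0 := by
          rw [← mulVec_smul, ← hX]
          exact (h.exact i _).2 ⟨_, rfl⟩
        exact (smul_eq_zero.1 h0).resolve_left (X_ne_zero p)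
    obtain ⟨y, hy⟩ := hy
    -- This cycle has constant coefficient 1 at `b`, against minimality.
    have := h.constantCoeff_eq_zero (x := Pi.single b 1 - (X p : MvPolynomial σ K) • y)
      (by rw [mulVec_sub, hX, mulVec_smul, hy, sub_self]) b
    simp at this

/-- Every multidegree in the minimal multigraded resolution of a monomial ideal is a multiple of
a monomial of the ideal. -/
theorem IsMinimalResolution.exists_le_deg
    (h : IsMinimalResolution (AddMonoidHom.id (σ →₀ ℕ)) deg D I) (hI : IsMonomialIdeal I) (i : ℕ)
    (b : C (i + 1)) : ∃ s ≤ deg (i + 1) b, monomial s (1 : K) ∈ I := by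
  classical
  have hcol : ∃ a, D i a b ≠ 0 := by
    by_contra! hzero
    have := h.constantCoeff_eq_zero (x := Pi.single b 1)
      (by rw [mulVec_single_one]; exact funext hzero) b
    simp at this
  obtain ⟨a, ha⟩ := hcol
  obtain ⟨s, hs⟩ := ne_zero_iff.1 ha
  have hdeg := h.graded i a b s hs
  rw [AddMonoidHom.id_apply] at hdeg
  cases i with
  | zero => exact ⟨s, by rw [← hdeg]; exact le_self_add, hI.monomial_mem (h.entry_mem a b) hs⟩
  | succ i =>
    obtain ⟨t, ht, htI⟩ := h.exists_le_deg hI i a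
    exact ⟨t, ht.trans (by rw [← hdeg]; exact le_add_self), htI⟩

/-- The ideal generated by the monomials of degree at most `α` of `I`, with `x_p` set to one. -/
def truncatedDehomogenization (I : Ideal (MvPolynomial σ K)) (α : σ →₀ ℕ) (p : σ) :
    Ideal (MvPolynomial σ K) :=
  Ideal.span ((fun s => monomial s (1 : K)) ''
    {t | ∃ s ≤ α, monomial s (1 : K) ∈ I ∧ t = s.erase p})

theorem mem_truncatedDehomogenization_of_X_mul_mem {α : σ →₀ ℕ} {p : σ} {f : MvPolynomial σ K}
    (hf : X p * f ∈ truncatedDehomogenization I α p) : f ∈ truncatedDehomogenization I α p := by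
  classical
  refine mem_ideal_span_monomial_image.2 fun s hs => ?_
  obtain ⟨_, ⟨r, hr, hrI, rfl⟩, hle⟩ := mem_ideal_span_monomial_image.1 hf (Finsupp.single p 1 + s)
    (by rw [mem_support_iff, coeff_X_mul]; exact mem_support_iff.1 hs)
  refine ⟨_, ⟨r, hr, hrI, rfl⟩, fun q => ?_⟩
  have := hle q
  by_cases hq : q = p
  · simp [hq]
  · simpa [Finsupp.single_apply, Ne.symm hq] using this

open Classical in
/-- The idempotent onto the summands `S(-deg c)` with `deg c ≤ α`. -/
def truncationMatrix (K : Type*) [Field K] {B : Type*} (degB : B → σ →₀ ℕ) (α : σ →₀ ℕ) :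
    Matrix B B (MvPolynomial σ K) :=
  diagonal fun c => if degB c ≤ α then 1 else 0

open Classical in
theorem mul_truncationMatrix_apply {A B : Type*} [Fintype B] (X : Matrix A B (MvPolynomial σ K))
    (degB : B → σ →₀ ℕ) (α : σ →₀ ℕ) (a : A) (b : B) :
    (X * truncationMatrix K degB α) a b = if degB b ≤ α then X a b else 0 := by
  rw [truncationMatrix, mul_diagonal, mul_ite, mul_one, mul_zero]

/-- A nonzero entry forces the row degree below the column degree, so the summands of degree ≤ α are
mapped into each other and form a subcomplex. -/
theorem IsGradedMatrix.truncationMatrix_mul_mul {A B : Type*} [Fintype A] [Fintype B]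
    {degA : A → σ →₀ ℕ} {degB : B → σ →₀ ℕ} {X : Matrix A B (MvPolynomial σ K)}
    (hX : IsGradedMatrix (AddMonoidHom.id _) degA degB X) (α : σ →₀ ℕ) :
    truncationMatrix K degA α * (X * truncationMatrix K degB α) =
      X * truncationMatrix K degB α := by
  classical
  ext1 a c
  rw [truncationMatrix, diagonal_mul, mul_truncationMatrix_apply]
  by_cases hz : X a c = 0
  · simp [hz]
  obtain ⟨s, hs⟩ := ne_zero_iff.1 hz
  have hdeg := hX a c s hs
  by_cases hc : degB c ≤ α
  · have : degA a ≤ α := le_trans (by rw [← hdeg]; exact le_add_self) hc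
    rw [if_pos this, one_mul]
  · rw [if_neg hc, mul_zero]

theorem IsGradedMatrix.mul_truncationMatrix {A B : Type*} [Fintype B]
    {degA : A → σ →₀ ℕ} {degB : B → σ →₀ ℕ} {X : Matrix A B (MvPolynomial σ K)}
    (hX : IsGradedMatrix (AddMonoidHom.id _) degA degB X) (α : σ →₀ ℕ) :
    IsGradedMatrix (AddMonoidHom.id _) degA degB (X * truncationMatrix K degB α) := by
  classical
  intro a c s hs
  rw [mul_truncationMatrix_apply] at hs
  refine hX a c s fun h0 => hs ?_
  split_ifs
  · exact h0
  · exact coeff_zero s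

theorem IsMinimalResolution.entry_mem_truncatedDehomogenization
    (h : IsMinimalResolution (AddMonoidHom.id (σ →₀ ℕ)) deg D I) (hI : IsMonomialIdeal I)
    (α : σ →₀ ℕ) (p : σ) (a : C 0) (c : C 1) :
    (D 0 * truncationMatrix K (deg 1) α) a c ∈ truncatedDehomogenization I α p := by
  classical
  rw [mul_truncationMatrix_apply]
  split_ifs with hc
  · refine Ideal.mem_of_forall_monomial_mem fun s hs => ?_
    have hdeg := h.graded 0 a c s hs
    rw [AddMonoidHom.id_apply, h.deg_zero, add_zero] at hdeg
    refine monomial_mem_of_le (s := s.erase p) (fun q => ?_) (Ideal.subset_span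
      ⟨_, ⟨s, hdeg ▸ hc, hI.monomial_mem (h.entry_mem a c) hs, rfl⟩, rfl⟩)
    rw [Finsupp.erase_apply]
    split_ifs <;> simp
  · exact zero_mem _

/-- If the part of `I` of multidegree at most `α` is contained in an ideal between `I` and `J` that
does not involve `x_p`, then a lift of the inclusion of `I` in `J` vanishes in degree `α` modulo
the ideal of the variables. -/
theorem IsMinimalResolution.constantCoeff_lift_eq_zero [Finite σ]
    (h : IsMinimalResolution (AddMonoidHom.id (σ →₀ ℕ)) deg D I) (hI : IsMonomialIdeal I)
    {M : Type*} [AddCommMonoid M] {wt : (σ →₀ ℕ) →+ M} {deg' : ∀ i, C' i → M}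
    (h' : IsMinimalResolution wt deg' D' J) {α : σ →₀ ℕ} {p : σ} (hp : α p ≠ 0)
    (hJ : truncatedDehomogenization I α p ≤ J)
    {φ : ∀ i, Matrix (C' i) (C i) (MvPolynomial σ K)} (hφ₀ : φ 0 = of fun _ _ => 1)
    (hφ : ∀ i, D' i * φ (i + 1) = φ i * D i) (i : ℕ) (a : C' (i + 1)) (b : C (i + 1))
    (hb : deg (i + 1) b = α) : constantCoeff (φ (i + 1) a b) = 0 := by
  classical
  obtain ⟨n, degR, R, hR⟩ := IsMonomialIdeal.exists_isMinimalResolution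
    (I := truncatedDehomogenization I α p) ⟨_, rfl⟩
  -- The source of a lift only has to be a complex, so exactness of the truncation is not needed.
  have hDD : ∀ i, D i * truncationMatrix K (deg (i + 1)) α *
      (D (i + 1) * truncationMatrix K (deg (i + 1 + 1)) α) = 0 := by
    intro i
    rw [Matrix.mul_assoc, (h.graded (i + 1)).truncationMatrix_mul_mul, ← Matrix.mul_assoc,
      h.exact.mul_eq_zero, Matrix.zero_mul]
  obtain ⟨ψ, hψ₀, hψ, hψg⟩ := hR.exists_lift (C := C) (deg := deg)
    (D := fun i => D i * truncationMatrix K (deg (i + 1)) α)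
    (fun i => (h.graded i).mul_truncationMatrix α) hDD h.deg_zero
    (h.entry_mem_truncatedDehomogenization hI α p)
  obtain ⟨χ, hχ₀, hχ, -⟩ := hR.ungraded.exists_comparison h'.ungraded hJ
  have hmin := isMinimalMatrix_sub_of_lifts
    (D := fun i => D i * truncationMatrix K (deg (i + 1)) α) hDD h'.exact
    (fun i => (h.minimal i).mul_left _) h'.minimal
    (φ := fun i => φ i * truncationMatrix K (deg i) α) (ψ := fun i => χ i * ψ i)
    (fun i => by
      rw [← Matrix.mul_assoc, hφ, Matrix.mul_assoc, Matrix.mul_assoc,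
        (h.graded i).truncationMatrix_mul_mul])
    (fun i => by rw [← Matrix.mul_assoc, hχ, Matrix.mul_assoc, hψ, Matrix.mul_assoc])
    (by
      have := hR.subsingleton
      obtain ⟨r⟩ := hR.nonempty
      ext1 x c
      rw [hφ₀, hχ₀, hψ₀, mul_truncationMatrix_apply, mul_apply, h.deg_zero, if_pos (zero_le),
        Fintype.sum_eq_single r fun r' hr' => absurd (Subsingleton.elim r' r) hr']
      simp) i a b
  -- A nonzero constant entry would give `R` a basis element of multidegree α, but its multidegrees
  -- vanish at `p`.
  have hψb : ∀ r, constantCoeff (ψ (i + 1) r b) = 0 := by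
    intro r
    by_contra hne
    have := DFunLike.congr_fun (hψg (i + 1) r b 0 hne) p
    rw [map_zero, zero_add, hR.deg_apply_eq_zero
      (fun f => mem_truncatedDehomogenization_of_X_mul_mem), hb] at this
    exact hp this.symm
  rw [Matrix.sub_apply, map_sub, mul_truncationMatrix_apply, if_pos hb.le, mul_apply, map_sum,
    sub_eq_zero] at hmin
  rw [hmin]
  exact Finset.sum_eq_zero fun r _ => by rw [map_mul, hψb, mul_zero]

/-- A sufficient condition for the vanishing, modulo the ideal of the variables, of the map of
minimal resolutions induced by an inclusion of monomial ideals. -/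
theorem IsMinimalResolution.isMinimalMatrix_of_lift [Finite σ]
    (h : IsMinimalResolution (AddMonoidHom.id (σ →₀ ℕ)) deg D I) (hI : IsMonomialIdeal I)
    {M : Type*} [AddCommMonoid M] {wt : (σ →₀ ℕ) →+ M} {deg' : ∀ i, C' i → M}
    (h' : IsMinimalResolution wt deg' D' J)
    (hIJ : ∀ α : σ →₀ ℕ, (∃ s ≤ α, monomial s (1 : K) ∈ I) → ∃ p, α p ≠ 0 ∧
      ∀ s ≤ α, monomial s (1 : K) ∈ I → monomial (s.erase p) (1 : K) ∈ J)
    {φ : ∀ i, Matrix (C' i) (C i) (MvPolynomial σ K)} (hφ₀ : φ 0 = of fun _ _ => 1)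
    (hφ : ∀ i, D' i * φ (i + 1) = φ i * D i) (i : ℕ) : IsMinimalMatrix (φ (i + 1)) := by
  intro a b
  obtain ⟨p, hp, hpJ⟩ := hIJ _ (h.exists_le_deg hI i b)
  refine h.constantCoeff_lift_eq_zero hI h' hp (Ideal.span_le.2 ?_) hφ₀ hφ i a b rfl
  rintro _ ⟨_, ⟨s, hs, hsI, rfl⟩, rfl⟩
  exact hpJ s hs hsI

end Monomial

/-! ## Comparison with `gradedBetti` -/

section GradedBetti

variable {σ K : Type*} [Field K] {I : Ideal (MvPolynomial σ K)}

theorem mem_span_range_X_iff {f : MvPolynomial σ K} :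
    f ∈ Ideal.span (Set.range (X : σ → MvPolynomial σ K)) ↔ constantCoeff f = 0 := by
  rw [← Set.image_univ, mem_ideal_span_X_image]
  constructor
  · intro h
    by_contra hne
    obtain ⟨p, -, hp⟩ := h 0 (mem_support_iff.2 hne)
    exact hp rfl
  · intro h s hs
    by_contra! h0
    obtain rfl : s = 0 := Finsupp.ext fun p => h0 p trivial
    exact mem_support_iff.1 hs h

theorem isHomogeneous_iff_degree {f : MvPolynomial σ K} {m : ℕ} :
    f.IsHomogeneous m ↔ ∀ s, coeff s f ≠ 0 → s.degree = m := by
  simp only [IsHomogeneous, IsWeightedHomogeneous, Finsupp.degree_eq_weight_one]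
  rfl

theorem mulVec_row_eq {A B : Type*} [Fintype B] [Subsingleton A]
    (X : Matrix A B (MvPolynomial σ K)) (a : A) (y : B → MvPolynomial σ K)
    (f : MvPolynomial σ K) : (X *ᵥ y = fun _ => f) ↔ ∑ b, y b * X a b = f := by
  rw [funext_iff]
  simp only [mulVec, dotProduct, mul_comm]
  exact ⟨fun h => h a, fun h a' => by rw [Subsingleton.elim a' a, h]⟩

/-- A minimal resolution by free modules with standard bases, as in the definition of
`gradedBetti`. -/
def IsMinimalResolution.toMinimalGradedFreeResolution {n : ℕ → ℕ} {deg : ∀ i, Fin (n i) → ℕ}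
    {D : ∀ i, Matrix (Fin (n i)) (Fin (n (i + 1))) (MvPolynomial σ K)}
    (h : IsMinimalResolution Finsupp.degree deg D I) : MinimalGradedFreeResolution I where
  rank i := n (i + 1)
  deg i := deg (i + 1)
  gen := D 0 h.nonempty.some
  d i := D (i + 1)
  gen_homogeneous b := isHomogeneous_iff_degree.2 fun s hs => by
    have := h.graded 0 _ b s hs
    rwa [h.deg_zero, add_zero] at this
  d_homogeneous i a b hne := by
    obtain ⟨s, hs⟩ := ne_zero_iff.1 hne
    refine ⟨s.degree, h.graded _ a b s hs, isHomogeneous_iff_degree.2 fun t ht => ?_⟩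
    exact Nat.add_right_cancel ((h.graded _ a b t ht).trans (h.graded _ a b s hs).symm)
  span_gen := by
    have := h.subsingleton
    ext f
    rw [Ideal.mem_span_range_iff_exists_fun, h.mem_iff]
    simp only [mulVec_row_eq _ h.nonempty.some]
  exact_zero x := by
    have := h.subsingleton
    rw [← h.exact 0 x, ← mulVec_row_eq _ h.nonempty.some x]
    rfl
  exact_succ i x := h.exact (i + 1) x
  minimal i a b := mem_span_range_X_iff.2 (h.minimal i a b)

namespace MinimalGradedFreeResolution

variable (R : MinimalGradedFreeResolution I)

/-- The ranks in the augmented resolution. -/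
def augRank : ℕ → ℕ
  | 0 => 1
  | i + 1 => R.rank i

/-- The degrees in the augmented resolution. -/
def augDeg : ∀ i, Fin (R.augRank i) → ℕ
  | 0 => fun _ => 0
  | i + 1 => R.deg i

/-- The matrices of the augmented resolution. -/
def augMatrix : ∀ i, Matrix (Fin (R.augRank i)) (Fin (R.augRank (i + 1))) (MvPolynomial σ K)
  | 0 => of fun _ b => R.gen b
  | i + 1 => R.d i

theorem isMinimalResolution : IsMinimalResolution Finsupp.degree R.augDeg R.augMatrix I where
  subsingleton := inferInstanceAs (Subsingleton (Fin 1))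
  nonempty := inferInstanceAs (Nonempty (Fin 1))
  deg_zero _ := rfl
  graded
    | 0 => fun _ b s hs => isHomogeneous_iff_degree.1 (R.gen_homogeneous b) s hs
    | i + 1 => fun a b s hs => by
      obtain ⟨m, hm, hhom⟩ := R.d_homogeneous i a b fun h0 => hs (by
        change coeff s (R.d i a b) = 0
        rw [h0, coeff_zero])
      rw [isHomogeneous_iff_degree.1 hhom s hs]
      exact hm
  exact
    | 0 => fun x => by
      refine Iff.trans ?_ (R.exact_zero x)
      have : Subsingleton (Fin (R.augRank 0)) := inferInstanceAs (Subsingleton (Fin 1))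
      exact mulVec_row_eq (R.augMatrix 0) (0 : Fin 1) x 0
    | i + 1 => R.exact_succ i
  minimal i a b := mem_span_range_X_iff.1 (R.minimal i a b)
  mem_iff f := by
    have : Subsingleton (Fin (R.augRank 0)) := inferInstanceAs (Subsingleton (Fin 1))
    simp only [mulVec_row_eq (R.augMatrix 0) (0 : Fin 1)]
    rw [← Ideal.mem_span_range_iff_exists_fun]
    change f ∈ I ↔ f ∈ Ideal.span (Set.range R.gen)
    rw [R.span_gen]

end MinimalGradedFreeResolution

/-- The graded Betti numbers can be read off from any minimal resolution. -/
theorem IsMinimalResolution.gradedBetti_eq [Finite σ] {C : ℕ → Type*} [∀ i, Fintype (C i)]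
    {deg : ∀ i, C i → ℕ} {D : ∀ i, Matrix (C i) (C (i + 1)) (MvPolynomial σ K)}
    (h : IsMinimalResolution Finsupp.degree deg D I) (hI : IsMonomialIdeal I) (i j : ℕ) :
    gradedBetti I i j = (Finset.univ.filter fun a => deg (i + 1) a = j).card := by
  obtain ⟨n, degR, R, hR⟩ := hI.exists_isMinimalResolution
  have hne : Nonempty (MinimalGradedFreeResolution I) :=
    ⟨(hR.map_weight Finsupp.degree).toMinimalGradedFreeResolution⟩
  rw [gradedBetti, dif_pos hne, ← Fintype.card_subtype, ← Fintype.card_subtype]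
  exact hne.some.isMinimalResolution.card_deg_eq h i j

end GradedBetti

/-! ## Mapping cones -/

section Cone

variable {σ K M : Type*} [Field K] [AddCommMonoid M]

/-- The bases of the free modules in the mapping cone of a map of complexes from `H` to `P`, with
the part in position zero replaced by `A`. -/
def ConeIndex (A : Type) (P H : ℕ → Type) : ℕ → Type
  | 0 => A
  | 1 => P 1
  | i + 2 => P (i + 2) ⊕ H (i + 1)

instance ConeIndex.fintype {A : Type} {P H : ℕ → Type} [Fintype A] [∀ i, Fintype (P i)]
    [∀ i, Fintype (H i)] : ∀ i, Fintype (ConeIndex A P H i)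
  | 0 => inferInstanceAs (Fintype A)
  | 1 => inferInstanceAs (Fintype (P 1))
  | i + 2 => inferInstanceAs (Fintype (P (i + 2) ⊕ H (i + 1)))

/-- The degrees in the mapping cone. -/
def coneDeg {A : Type} {P H : ℕ → Type} (degP : ∀ i, P i → M) (degH : ∀ i, H i → M) :
    ∀ i, ConeIndex A P H i → M
  | 0 => fun _ => 0
  | 1 => degP 1
  | i + 2 => Sum.elim (degP (i + 2)) (degH (i + 1))

/-- The matrices of the mapping cone. -/
def coneMatrix {A : Type} {P H : ℕ → Type} (ε : Matrix A (P 1) (MvPolynomial σ K))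
    (DP : ∀ i, Matrix (P i) (P (i + 1)) (MvPolynomial σ K))
    (DH : ∀ i, Matrix (H i) (H (i + 1)) (MvPolynomial σ K))
    (Φ : ∀ i, Matrix (P i) (H i) (MvPolynomial σ K)) :
    ∀ i, Matrix (ConeIndex A P H i) (ConeIndex A P H (i + 1)) (MvPolynomial σ K)
  | 0 => ε
  | 1 => fromCols (DP 1) (Φ 1)
  | i + 2 => fromBlocks (DP (i + 2)) (Φ (i + 2)) 0 (-DH (i + 1))

variable {A : Type} {P H : ℕ → Type}
  {ε : Matrix A (P 1) (MvPolynomial σ K)}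
  {DP : ∀ i, Matrix (P i) (P (i + 1)) (MvPolynomial σ K)}
  {DH : ∀ i, Matrix (H i) (H (i + 1)) (MvPolynomial σ K)}
  {Φ : ∀ i, Matrix (P i) (H i) (MvPolynomial σ K)}

theorem coneMatrix_isGradedMatrix {wt : (σ →₀ ℕ) →+ M} {degP : ∀ i, P i → M}
    {degH : ∀ i, H i → M} (hP : ∀ i, IsGradedMatrix wt (degP i) (degP (i + 1)) (DP i))
    (hH : ∀ i, IsGradedMatrix wt (degH i) (degH (i + 1)) (DH i))
    (hΦ : ∀ i, IsGradedMatrix wt (degP i) (degH i) (Φ i))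
    (hε : IsGradedMatrix wt (fun _ => 0) (degP 1) ε) :
    ∀ i, IsGradedMatrix wt (coneDeg (A := A) degP degH i) (coneDeg degP degH (i + 1))
      (coneMatrix ε DP DH Φ i)
  | 0 => hε
  | 1 => by
    rintro a (b | b) s hs
    · exact hP 1 a b s hs
    · exact hΦ 1 a b s hs
  | i + 2 => by
    rintro (a | a) (b | b) s hs
    · exact hP (i + 2) a b s hs
    · exact hΦ (i + 2) a b s hs
    · exact absurd (coeff_zero s) hs
    · refine hH (i + 1) a b s fun h0 => hs ?_
      change coeff s (-DH (i + 1) a b) = 0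
      rw [coeff_neg, h0, neg_zero]

theorem coneMatrix_isMinimalMatrix (hP : ∀ i, IsMinimalMatrix (DP (i + 1)))
    (hH : ∀ i, IsMinimalMatrix (DH (i + 1))) (hΦ : ∀ i, IsMinimalMatrix (Φ (i + 1))) :
    ∀ i, IsMinimalMatrix (coneMatrix ε DP DH Φ (i + 1))
  | 0 => by
    rintro a (b | b)
    · exact hP 0 a b
    · exact hΦ 0 a b
  | i + 1 => by
    rintro (a | a) (b | b)
    · exact hP (i + 1) a b
    · exact hΦ (i + 1) a b
    · exact map_zero _
    · change constantCoeff (-DH (i + 1) a b) = 0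
      rw [map_neg, hH i a b, neg_zero]

variable [Fintype A] [∀ i, Fintype (P i)] [∀ i, Fintype (H i)]

theorem cone_exact_aux (hP : IsExactSeq DP) (hH : IsExactSeq DH)
    (hΦ : ∀ i, DP i * Φ (i + 1) = Φ i * DH i) (i : ℕ)
    (x : P (i + 2) ⊕ H (i + 1) → MvPolynomial σ K) :
    (DP (i + 1) *ᵥ (x ∘ Sum.inl) + Φ (i + 1) *ᵥ (x ∘ Sum.inr) = 0 ∧
      DH i *ᵥ (x ∘ Sum.inr) = 0) ↔
      ∃ y : P (i + 3) ⊕ H (i + 2) → MvPolynomial σ K,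
        fromBlocks (DP (i + 2)) (Φ (i + 2)) 0 (-DH (i + 1)) *ᵥ y = x := by
  constructor
  · rintro ⟨h1, h2⟩
    obtain ⟨h', hh'⟩ := (hH i _).1 h2
    rw [← hh'] at h1
    obtain ⟨p', hp'⟩ := (hP (i + 1) (x ∘ Sum.inl + Φ (i + 2) *ᵥ h')).1 (by
      rw [mulVec_add, mulVec_mulVec, hΦ, ← mulVec_mulVec, h1])
    -- The sign compensates the block `-DH`.
    refine ⟨Sum.elim p' (-h'), ?_⟩
    rw [fromBlocks_mulVec, ← Sum.elim_comp_inl_inr x]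
    simp [Sum.elim_comp_inl, Sum.elim_comp_inr, hp', hh', mulVec_neg, neg_mulVec]
  · rintro ⟨y, rfl⟩
    rw [fromBlocks_mulVec, Sum.elim_comp_inl, Sum.elim_comp_inr, zero_mulVec, zero_add]
    refine ⟨?_, (hH i _).2 ⟨-(y ∘ Sum.inr), by rw [mulVec_neg, neg_mulVec]⟩⟩
    rw [mulVec_add, (hP (i + 1) _).2 ⟨_, rfl⟩, zero_add, mulVec_mulVec, hΦ, neg_mulVec, mulVec_neg,
      mulVec_mulVec, add_neg_cancel]

theorem fromBlocks_zero_neg_mulVec_eq_zero_iff {A₁ A₂ B₁ B₂ : Type*} [Fintype B₁] [Fintype B₂]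
    (X : Matrix A₁ B₁ (MvPolynomial σ K)) (Y : Matrix A₁ B₂ (MvPolynomial σ K))
    (Z : Matrix A₂ B₂ (MvPolynomial σ K)) (x : B₁ ⊕ B₂ → MvPolynomial σ K) :
    fromBlocks X Y 0 (-Z) *ᵥ x = 0 ↔
      X *ᵥ (x ∘ Sum.inl) + Y *ᵥ (x ∘ Sum.inr) = 0 ∧ Z *ᵥ (x ∘ Sum.inr) = 0 := by
  rw [fromBlocks_mulVec, zero_mulVec, zero_add, neg_mulVec, ← Sum.elim_zero_zero, Sum.elim_eq_iff,
    neg_eq_zero]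

/-- The two lowest positions need separate input: `hΦ₀` is the injectivity of the augmented map, and
`hε` is exactness at the replaced augmentation. -/
theorem coneMatrix_isExactSeq (hP : IsExactSeq DP) (hH : IsExactSeq DH)
    (hΦ : ∀ i, DP i * Φ (i + 1) = Φ i * DH i)
    (hΦ₀ : ∀ h, DP 0 *ᵥ (Φ 1 *ᵥ h) = 0 → DH 0 *ᵥ h = 0)
    (hε : ∀ x, ε *ᵥ x = 0 ↔ ∃ p h, DP 1 *ᵥ p + Φ 1 *ᵥ h = x) :
    IsExactSeq (coneMatrix ε DP DH Φ)
  | 0 => fun x => by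
    refine (hε x).trans ⟨?_, ?_⟩
    · rintro ⟨p, h, hx⟩
      exact ⟨Sum.elim p h, (fromCols_mulVec_sumElim _ _ _ _).trans hx⟩
    · rintro ⟨y, hy⟩
      exact ⟨y ∘ Sum.inl, y ∘ Sum.inr, (fromCols_mulVec _ _ _).symm.trans hy⟩
  | 1 => fun x => by
    refine Iff.trans ?_ (cone_exact_aux hP hH hΦ 0 x)
    refine Iff.trans (Eq.congr_left (fromCols_mulVec (DP 1) (Φ 1) x)) ?_
    refine ⟨fun hx => ⟨hx, hΦ₀ _ ?_⟩, fun hx => hx.1⟩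
    have := congrArg (DP 0 *ᵥ ·) hx
    simp only [mulVec_add, (hP 0 _).2 ⟨_, rfl⟩, zero_add] at this
    exact this.trans (mulVec_zero _)
  | i + 2 => fun x => (fromBlocks_zero_neg_mulVec_eq_zero_iff _ _ _ x).trans
      (cone_exact_aux hP hH hΦ (i + 1) x)

end Cone

/-! ## Betti splittings from mapping cones -/

section Splitting

variable {σ K M : Type*} [Field K] [AddCommMonoid M]

theorem isExactSeq_fromBlocks {F G : ℕ → Type*} [∀ i, Fintype (F i)] [∀ i, Fintype (G i)]
    {DF : ∀ i, Matrix (F i) (F (i + 1)) (MvPolynomial σ K)}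
    {DG : ∀ i, Matrix (G i) (G (i + 1)) (MvPolynomial σ K)} (hF : IsExactSeq DF)
    (hG : IsExactSeq DG) :
    IsExactSeq (C := fun i => F i ⊕ G i) fun i => fromBlocks (DF i) 0 0 (DG i) := by
  intro i x
  simp only [fromBlocks_mulVec, zero_mulVec, add_zero, zero_add]
  rw [← Sum.elim_zero_zero, Sum.elim_eq_iff, hF, hG]
  constructor
  · rintro ⟨⟨y, hy⟩, z, hz⟩
    exact ⟨Sum.elim y z, by
      rw [Sum.elim_comp_inl, Sum.elim_comp_inr, hy, hz, Sum.elim_comp_inl_inr]⟩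
  · rintro ⟨y, rfl⟩
    exact ⟨⟨_, rfl⟩, _, rfl⟩

theorem of_one_mulVec {A B : Type*} [Fintype B] [Subsingleton B] (b : B)
    (x : B → MvPolynomial σ K) : (of fun (_ : A) (_ : B) => (1 : MvPolynomial σ K)) *ᵥ x =
      fun _ => x b := by
  funext a
  rw [mulVec, dotProduct, Fintype.sum_eq_single b fun b' hb' => absurd (Subsingleton.elim b' b) hb']
  simp

theorem IsGradedMatrix.neg {A B : Type*} {wt : (σ →₀ ℕ) →+ M} {degA : A → M} {degB : B → M}
    {X : Matrix A B (MvPolynomial σ K)} (hX : IsGradedMatrix wt degA degB X) :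
    IsGradedMatrix wt degA degB (-X) := by
  intro a b s hs
  refine hX a b s fun h0 => hs ?_
  rw [Matrix.neg_apply, coeff_neg, h0, neg_zero]

theorem IsMinimalMatrix.neg {A B : Type*} {X : Matrix A B (MvPolynomial σ K)}
    (hX : IsMinimalMatrix X) : IsMinimalMatrix (-X) := by
  intro a b
  rw [Matrix.neg_apply, map_neg, hX, neg_zero]

/-- This is the cone of h ↦ (φ h, -ψ h), with the two copies of the polynomial ring in position zero
merged into one by adding the augmentations. Minimality of `φ` and `ψ` makes the off-diagonal block
minimal. -/
theorem IsMinimalResolution.cone {F G H : ℕ → Type} [∀ i, Fintype (F i)] [∀ i, Fintype (G i)]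
    [∀ i, Fintype (H i)] {wt : (σ →₀ ℕ) →+ M}
    {degF : ∀ i, F i → M} {degG : ∀ i, G i → M} {degH : ∀ i, H i → M}
    {DF : ∀ i, Matrix (F i) (F (i + 1)) (MvPolynomial σ K)}
    {DG : ∀ i, Matrix (G i) (G (i + 1)) (MvPolynomial σ K)}
    {DH : ∀ i, Matrix (H i) (H (i + 1)) (MvPolynomial σ K)} {I₁ I₂ : Ideal (MvPolynomial σ K)}
    (hF : IsMinimalResolution wt degF DF I₁) (hG : IsMinimalResolution wt degG DG I₂)
    (hH : IsMinimalResolution wt degH DH (I₁ ⊓ I₂))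
    {φ : ∀ i, Matrix (F i) (H i) (MvPolynomial σ K)}
    {ψ : ∀ i, Matrix (G i) (H i) (MvPolynomial σ K)}
    (hφ₀ : φ 0 = of fun _ _ => 1) (hφ : ∀ i, DF i * φ (i + 1) = φ i * DH i)
    (hφg : ∀ i, IsGradedMatrix wt (degF i) (degH i) (φ i))
    (hφm : ∀ i, IsMinimalMatrix (φ (i + 1)))
    (hψ₀ : ψ 0 = of fun _ _ => 1) (hψ : ∀ i, DG i * ψ (i + 1) = ψ i * DH i)
    (hψg : ∀ i, IsGradedMatrix wt (degG i) (degH i) (ψ i))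
    (hψm : ∀ i, IsMinimalMatrix (ψ (i + 1))) :
    IsMinimalResolution (C := ConeIndex (F 0) (fun i => F i ⊕ G i) H) wt
      (coneDeg (fun i => Sum.elim (degF i) (degG i)) degH)
      (coneMatrix (P := fun i => F i ⊕ G i)
        (fromCols (DF 0) ((of fun _ _ => 1 : Matrix (F 0) (G 0) (MvPolynomial σ K)) * DG 0))
        (fun i => fromBlocks (DF i) 0 0 (DG i)) DH (fun i => fromRows (φ i) (-ψ i)))
      (I₁ ⊔ I₂) := by
  have hFs := hF.subsingleton
  have hGs := hG.subsingleton
  have hHs := hH.subsingleton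
  obtain ⟨f₀⟩ := hF.nonempty
  obtain ⟨g₀⟩ := hG.nonempty
  obtain ⟨h₀⟩ := hH.nonempty
  have hε : ∀ x : F 1 ⊕ G 1 → MvPolynomial σ K,
      fromCols (DF 0) ((of fun _ _ => 1 : Matrix (F 0) (G 0) (MvPolynomial σ K)) * DG 0) *ᵥ x =
        fun _ => (DF 0 *ᵥ (x ∘ Sum.inl)) f₀ + (DG 0 *ᵥ (x ∘ Sum.inr)) g₀ := by
    intro x
    rw [fromCols_mulVec, ← mulVec_mulVec, of_one_mulVec g₀]
    funext a
    rw [Subsingleton.elim a f₀]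
    rfl
  have hφ1 : ∀ h, (DF 0 *ᵥ (φ 1 *ᵥ h)) = fun _ => (DH 0 *ᵥ h) h₀ := by
    intro h
    rw [mulVec_mulVec, hφ, hφ₀, ← mulVec_mulVec, of_one_mulVec h₀]
  have hψ1 : ∀ h, (DG 0 *ᵥ (ψ 1 *ᵥ h)) = fun _ => (DH 0 *ᵥ h) h₀ := by
    intro h
    rw [mulVec_mulVec, hψ, hψ₀, ← mulVec_mulVec, of_one_mulVec h₀]
  exact {
    subsingleton := hFs
    nonempty := ⟨f₀⟩
    deg_zero := fun _ => rfl
    graded := by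
      refine coneMatrix_isGradedMatrix ?_ hH.graded ?_ ?_
      · rintro i (a | a) (b | b) s hs
        · exact hF.graded i a b s hs
        · exact absurd (coeff_zero s) hs
        · exact absurd (coeff_zero s) hs
        · exact hG.graded i a b s hs
      · rintro i (a | a) b s hs
        · exact hφg i a b s hs
        · exact (hψg i).neg a b s hs
      · rintro a (b | b) s hs
        · rw [← hF.deg_zero a]
          exact hF.graded 0 a b s hs
        · rw [← hG.deg_zero g₀]
          refine hG.graded 0 g₀ b s fun h => hs ?_
          rw [fromCols_apply_inr, mul_apply,
            Fintype.sum_eq_single g₀ fun b' hb' => absurd (Subsingleton.elim b' g₀) hb', of_apply,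
            one_mul, h]
    minimal := by
      refine coneMatrix_isMinimalMatrix ?_ hH.minimal ?_
      · rintro i (a | a) (b | b)
        · exact hF.minimal i a b
        · exact map_zero _
        · exact map_zero _
        · exact hG.minimal i a b
      · rintro i (a | a) b
        · exact hφm i a b
        · exact (hψm i).neg a b
    exact := by
      refine coneMatrix_isExactSeq (isExactSeq_fromBlocks hF.exact hG.exact) hH.exact ?_ ?_ ?_
      · intro i
        rw [fromBlocks_mul_fromRows, fromRows_mul, Matrix.zero_mul, Matrix.zero_mul,
          Matrix.mul_neg, hφ, hψ, add_zero, zero_add, Matrix.neg_mul]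
      · intro h hh
        rw [fromBlocks_mulVec, fromRows_mulVec, Sum.elim_comp_inl, zero_mulVec, add_zero, hφ1] at hh
        funext a
        rw [Subsingleton.elim a h₀]
        exact congrFun hh (Sum.inl f₀)
      · intro x
        rw [hε]
        constructor
        · intro hx
          have hx' := congrFun hx f₀
          -- The two augmentations are negatives of each other, so their value lies in both ideals;
          -- subtracting the image of a lift `h` to `H 1` leaves cycles in `F` and `G`.
          have hmem : (DF 0 *ᵥ (x ∘ Sum.inl)) f₀ ∈ I₁ ⊓ I₂ := by
            refine ⟨hF.mulVec_mem _ _, ?_⟩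
            rw [eq_neg_of_add_eq_zero_left hx']
            exact I₂.neg_mem (hG.mulVec_mem _ _)
          obtain ⟨h, hh⟩ := (hH.mem_iff _).1 hmem
          have hh₀ := congrFun hh h₀
          obtain ⟨p, hp⟩ := (hF.exact 0 (x ∘ Sum.inl - φ 1 *ᵥ h)).1 (by
            rw [mulVec_sub, hφ1, hh₀]
            funext a
            rw [Subsingleton.elim a f₀]
            exact sub_self _)
          obtain ⟨q, hq⟩ := (hG.exact 0 (x ∘ Sum.inr + ψ 1 *ᵥ h)).1 (by
            rw [mulVec_add, hψ1, hh₀]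
            funext a
            rw [Subsingleton.elim a g₀]
            exact (add_comm _ _).trans hx')
          refine ⟨Sum.elim p q, h, ?_⟩
          rw [fromBlocks_mulVec, fromRows_mulVec, Sum.elim_comp_inl, Sum.elim_comp_inr, hp, hq,
            zero_mulVec, zero_mulVec, add_zero, zero_add, neg_mulVec]
          funext a
          rcases a with a | a <;> simp
        · rintro ⟨p, h, rfl⟩
          funext a
          simp only [fromBlocks_mulVec, fromRows_mulVec, zero_mulVec, add_zero, zero_add]
          have e1 := congrFun ((hF.exact 0 _).2 ⟨p ∘ Sum.inl, rfl⟩) f₀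
          have e2 := congrFun ((hG.exact 0 _).2 ⟨p ∘ Sum.inr, rfl⟩) g₀
          have e3 := congrFun (hφ1 h) f₀
          have e4 := congrFun (hψ1 h) g₀
          change (DF 0 *ᵥ (DF 1 *ᵥ (p ∘ Sum.inl) + φ 1 *ᵥ h)) f₀ +
            (DG 0 *ᵥ (DG 1 *ᵥ (p ∘ Sum.inr) + -ψ 1 *ᵥ h)) g₀ = 0
          rw [mulVec_add, mulVec_add, neg_mulVec, mulVec_neg, Pi.add_apply, Pi.add_apply,
            Pi.neg_apply, e1, e2, e3, e4]
          simp
    mem_iff := by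
      intro f
      rw [Submodule.mem_sup]
      constructor
      · rintro ⟨f₁, h₁, f₂, h₂, rfl⟩
        obtain ⟨y, hy⟩ := (hF.mem_iff _).1 h₁
        obtain ⟨z, hz⟩ := (hG.mem_iff _).1 h₂
        refine ⟨Sum.elim y z, (hε _).trans ?_⟩
        rw [Sum.elim_comp_inl, Sum.elim_comp_inr, hy, hz]
        rfl
      · rintro ⟨y, hy⟩
        exact ⟨_, hF.mulVec_mem _ _, _, hG.mulVec_mem _ _, congrFun ((hε y).symm.trans hy) f₀⟩ }

theorem card_filter_sumElim {A B : Type*} [Fintype A] [Fintype B] (f : A → ℕ) (g : B → ℕ) (j : ℕ) :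
    (Finset.univ.filter fun a => Sum.elim f g a = j).card =
      (Finset.univ.filter fun a => f a = j).card + (Finset.univ.filter fun a => g a = j).card := by
  simp only [Finset.card_filter, Fintype.sum_sum_type, Sum.elim_inl, Sum.elim_inr]
  rfl

/-- The condition of `IsMinimalResolution.isMinimalMatrix_of_lift`, under which the inclusion of
monomial ideals `I ≤ J` induces zero maps on the Betti numbers. -/
def IsBettiVanishing (I J : Ideal (MvPolynomial σ K)) : Prop :=
  ∀ α : σ →₀ ℕ, (∃ s ≤ α, monomial s (1 : K) ∈ I) → ∃ p, α p ≠ 0 ∧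
    ∀ s ≤ α, monomial s (1 : K) ∈ I → monomial (s.erase p) (1 : K) ∈ J

theorem gradedBetti_sup [Finite σ] {I₁ I₂ : Ideal (MvPolynomial σ K)} (h₁ : IsMonomialIdeal I₁)
    (h₂ : IsMonomialIdeal I₂) (h₃ : IsMonomialIdeal (I₁ ⊓ I₂)) (h : IsMonomialIdeal (I₁ ⊔ I₂))
    (hv₁ : IsBettiVanishing (I₁ ⊓ I₂) I₁) (hv₂ : IsBettiVanishing (I₁ ⊓ I₂) I₂) :
    (∀ j, gradedBetti (I₁ ⊔ I₂) 0 j = gradedBetti I₁ 0 j + gradedBetti I₂ 0 j) ∧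
    ∀ i j, gradedBetti (I₁ ⊔ I₂) (i + 1) j =
      gradedBetti I₁ (i + 1) j + gradedBetti I₂ (i + 1) j + gradedBetti (I₁ ⊓ I₂) i j := by
  obtain ⟨_, _, _, hF⟩ := h₁.exists_isMinimalResolution
  obtain ⟨_, _, _, hG⟩ := h₂.exists_isMinimalResolution
  obtain ⟨_, _, _, hH⟩ := h₃.exists_isMinimalResolution
  obtain ⟨φ, hφ₀, hφ, hφg⟩ := hH.exists_comparison hF inf_le_left
  obtain ⟨ψ, hψ₀, hψ, hψg⟩ := hH.exists_comparison hG inf_le_right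
  have hφm := hH.isMinimalMatrix_of_lift h₃ hF hv₁ hφ₀ hφ
  have hψm := hH.isMinimalMatrix_of_lift h₃ hG hv₂ hψ₀ hψ
  have hF' := hF.map_weight Finsupp.degree
  have hG' := hG.map_weight Finsupp.degree
  have hH' := hH.map_weight Finsupp.degree
  have hE := hF'.cone hG' hH' hφ₀ hφ (fun i => (hφg i).map_weight _) hφm hψ₀ hψ
    (fun i => (hψg i).map_weight _) hψm
  rw [AddMonoidHom.comp_id] at hF' hG' hH' hE
  refine ⟨fun j => ?_, fun i j => ?_⟩
  · rw [hE.gradedBetti_eq h, hF'.gradedBetti_eq h₁, hG'.gradedBetti_eq h₂]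
    exact card_filter_sumElim _ _ j
  -- The cone in position i + 2 contains `H` in position i + 1, whence the index shift for the
  -- intersection.
  · rw [hE.gradedBetti_eq h, hF'.gradedBetti_eq h₁, hG'.gradedBetti_eq h₂, hH'.gradedBetti_eq h₃,
      ← card_filter_sumElim, ← card_filter_sumElim]
    rfl

end Splitting

/-! ## Squarefree monomial ideals -/

section Squarefree

variable {σ K : Type*} [Field K] {I J : Ideal (MvPolynomial σ K)} {P Q : Set σ → Prop}

/-- `I` is the ideal spanned by the monomials whose support satisfies `P`. -/
def IsSupportIdeal (I : Ideal (MvPolynomial σ K)) (P : Set σ → Prop) : Prop :=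
  ∀ f, f ∈ I ↔ ∀ s, coeff s f ≠ 0 → P (Function.support s)

theorem IsSupportIdeal.monomial_mem_iff (h : IsSupportIdeal I P) (s : σ →₀ ℕ) :
    monomial s (1 : K) ∈ I ↔ P (Function.support s) := by
  classical
  rw [h]
  simp [coeff_monomial]

theorem IsSupportIdeal.eq (hI : IsSupportIdeal I P) (hJ : IsSupportIdeal J Q)
    (hPQ : ∀ U, P U ↔ Q U) : I = J := by
  ext f
  simp only [hI f, hJ f, hPQ]

theorem IsSupportIdeal.isMonomialIdeal (hI : IsSupportIdeal I P) (hP : Monotone P) :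
    IsMonomialIdeal I := by
  refine ⟨{s | P (Function.support s)}, ?_⟩
  ext f
  rw [hI f, mem_ideal_span_monomial_image]
  simp only [mem_support_iff]
  refine forall₂_congr fun s _ => ⟨fun h => ⟨s, h, le_rfl⟩, ?_⟩
  rintro ⟨t, ht, hts⟩
  refine hP (fun x hx => ?_) ht
  have := hts x
  rw [Function.mem_support] at hx ⊢
  omega

theorem IsSupportIdeal.inf (hI : IsSupportIdeal I P) (hJ : IsSupportIdeal J Q) :
    IsSupportIdeal (I ⊓ J) fun U => P U ∧ Q U := by
  intro f
  rw [Submodule.mem_inf, hI f, hJ f]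
  exact ⟨fun h s hs => ⟨h.1 s hs, h.2 s hs⟩,
    fun h => ⟨fun s hs => (h s hs).1, fun s hs => (h s hs).2⟩⟩

theorem IsSupportIdeal.sup (hI : IsSupportIdeal I P) (hJ : IsSupportIdeal J Q) :
    IsSupportIdeal (I ⊔ J) fun U => P U ∨ Q U := by
  intro f
  constructor
  · intro hf s hs
    obtain ⟨g, hg, h, hh, rfl⟩ := Submodule.mem_sup.1 hf
    by_cases hgs : coeff s g = 0
    · refine Or.inr ((hJ h).1 hh s fun hhs => hs ?_)
      rw [coeff_add, hgs, hhs, add_zero]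
    · exact Or.inl ((hI g).1 hg s hgs)
  · intro h
    refine Ideal.mem_of_forall_monomial_mem fun s hs => ?_
    rcases h s hs with h' | h'
    · exact Submodule.mem_sup_left ((hI.monomial_mem_iff s).2 h')
    · exact Submodule.mem_sup_right ((hJ.monomial_mem_iff s).2 h')

theorem isSupportIdeal_sum {ι : Type*} (T : Finset ι) {I : ι → Ideal (MvPolynomial σ K)}
    {P : ι → Set σ → Prop} (h : ∀ i ∈ T, IsSupportIdeal (I i) (P i)) :
    IsSupportIdeal (∑ i ∈ T, I i) fun U => ∃ i ∈ T, P i U := by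
  classical
  induction T using Finset.induction_on with
  | empty =>
    intro f
    rw [Finset.sum_empty, Ideal.zero_eq_bot, Ideal.mem_bot, MvPolynomial.ext_iff]
    simp
  | insert i T hi ih =>
    rw [Finset.sum_insert hi]
    have := (h i (Finset.mem_insert_self i T)).sup
      (ih fun j hj => h j (Finset.mem_insert_of_mem hj))
    rw [Submodule.add_eq_sup]
    simpa only [Finset.exists_mem_insert] using this

theorem support_erase' (s : σ →₀ ℕ) (p : σ) :
    Function.support (s.erase p) = Function.support s \ {p} := by
  classical
  ext x
  simp only [Function.mem_support, Finsupp.erase_apply, Set.mem_sdiff, Set.mem_singleton_iff]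
  split_ifs with h <;> simp [h]

/-- Dividing by `x_p` changes the support at most by removing `p`, and `hp` with monotonicity makes
`P` insensitive to that. -/
theorem IsSupportIdeal.X_mul (hI : IsSupportIdeal I P) {p : σ} (hP : Monotone P)
    (hp : ∀ U, P U → P (U \ {p})) :
    IsSupportIdeal (Ideal.span {X p} * I) fun U => p ∈ U ∧ P U := by
  classical
  intro f
  rw [Ideal.mem_span_singleton_mul]
  constructor
  · rintro ⟨g, hg, rfl⟩ s hs
    rw [coeff_X_mul'] at hs
    obtain ⟨hps, hs⟩ := ite_ne_right_iff.1 hs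
    refine ⟨Finsupp.mem_support_iff.1 hps, hP (fun x hx => ?_) ((hI g).1 hg _ hs)⟩
    rw [Function.mem_support, Finsupp.tsub_apply] at hx
    rw [Function.mem_support]
    omega
  · intro h
    rw [← Ideal.mem_span_singleton_mul]
    refine Ideal.mem_of_forall_monomial_mem fun s hs => Ideal.mem_span_singleton_mul.2 ?_
    obtain ⟨hps, hPs⟩ := h s hs
    refine ⟨monomial (s - Finsupp.single p 1) 1, (hI.monomial_mem_iff _).2
      (hP (fun x hx => ?_) (hp _ hPs)), ?_⟩
    · rw [Function.mem_support, Finsupp.tsub_apply, Finsupp.single_apply,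
        if_neg (Ne.symm hx.2), tsub_zero]
      exact hx.1
    · rw [X, monomial_mul, one_mul, add_tsub_cancel_of_le]
      rw [Finsupp.single_le_iff]
      exact Nat.one_le_iff_ne_zero.2 hps

end Squarefree

/-! ## Matchings -/

section Matchings

variable {V : Type*} {G : SimpleGraph V} {k : ℕ} {U W : Set V}

/-- `G` has a `k`-matching whose vertices lie in `U`. -/
def HasMatchingIn (G : SimpleGraph V) (k : ℕ) (U : Set V) : Prop :=
  ∃ M, IsKMatching G k M ∧ ∀ e ∈ M, ∀ x ∈ e, x ∈ U

theorem HasMatchingIn.mono (h : HasMatchingIn G k U) (hUW : U ⊆ W) : HasMatchingIn G k W := by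
  obtain ⟨M, hM, hMU⟩ := h
  exact ⟨M, hM, fun e he x hx => hUW (hMU e he x hx)⟩

theorem IsKMatching.erase [DecidableEq (Sym2 V)] {M : Finset (Sym2 V)}
    (hM : IsKMatching G (k + 1) M) {e : Sym2 V} (he : e ∈ M) : IsKMatching G k (M.erase e) := by
  refine ⟨fun f hf => hM.1 (Finset.mem_of_mem_erase hf), ?_, fun f hf f' hf' =>
    hM.2.2 f (Finset.mem_of_mem_erase hf) f' (Finset.mem_of_mem_erase hf')⟩
  rw [Finset.card_erase_of_mem he, hM.2.1, Nat.add_sub_cancel]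

/-- At most one edge covers `x`: discard it, or any edge if there is none. -/
theorem HasMatchingIn.of_succ_diff (h : HasMatchingIn G (k + 1) U) (x : V) :
    HasMatchingIn G k (U \ {x}) := by
  classical
  obtain ⟨M, hM, hMU⟩ := h
  obtain ⟨e, he, hex⟩ : ∃ e ∈ M, ∀ f ∈ M, x ∈ f → f = e := by
    by_cases hx : ∃ e ∈ M, x ∈ e
    · obtain ⟨e, he, hxe⟩ := hx
      exact ⟨e, he, fun f hf hxf => by_contra fun hne => hM.2.2 f hf e he hne x hxf hxe⟩
    · push Not at hx
      obtain ⟨e, he⟩ := Finset.card_pos.1 (hM.2.1.symm ▸ Nat.succ_pos k : 0 < M.card)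
      exact ⟨e, he, fun f hf hxf => absurd hxf (hx f hf)⟩
  refine ⟨M.erase e, hM.erase he, fun f hf y hy => ⟨hMU f (Finset.mem_of_mem_erase hf) y hy, ?_⟩⟩
  rintro rfl
  exact Finset.ne_of_mem_erase hf (hex f (Finset.mem_of_mem_erase hf) hy)

theorem HasMatchingIn.of_succ (h : HasMatchingIn G (k + 1) U) : HasMatchingIn G k U := by
  obtain ⟨M, hM, hMU⟩ := h
  classical
  obtain ⟨e, he⟩ := Finset.card_pos.1 (hM.2.1.symm ▸ Nat.succ_pos k : 0 < M.card)
  exact ⟨M.erase e, hM.erase he, fun f hf => hMU f (Finset.mem_of_mem_erase hf)⟩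

theorem HasMatchingIn.exists_mem (h : HasMatchingIn G (k + 1) U) : U.Nonempty := by
  obtain ⟨M, hM, hMU⟩ := h
  obtain ⟨e, he⟩ := Finset.card_pos.1 (hM.2.1.symm ▸ Nat.succ_pos k : 0 < M.card)
  exact ⟨_, hMU e he _ e.out_fst_mem⟩

/-- A matching either avoids the vertex `p` or contains an edge at `p`. -/
theorem HasMatchingIn.diff_or (h : HasMatchingIn G (k + 1) U) (p : V) :
    HasMatchingIn G (k + 1) (U \ {p}) ∨
      p ∈ U ∧ ∃ q ∈ U, G.Adj p q ∧ HasMatchingIn G k (U \ {p, q}) := by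
  classical
  obtain ⟨M, hM, hMU⟩ := h
  by_cases hp : ∃ e ∈ M, p ∈ e
  · obtain ⟨e, he, hpe⟩ := hp
    obtain ⟨q, rfl⟩ := Sym2.mem_iff_exists.1 hpe
    refine Or.inr ⟨hMU _ he p hpe, q, hMU _ he q (Sym2.mem_mk_right p q), hM.1 he,
      M.erase s(p, q), hM.erase he, fun f hf x hx => ⟨hMU f (Finset.mem_of_mem_erase hf) x hx, ?_⟩⟩
    intro hxpq
    exact hM.2.2 f (Finset.mem_of_mem_erase hf) _ he (Finset.ne_of_mem_erase hf) x hx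
      (Sym2.mem_iff.2 hxpq)
  · push Not at hp
    refine Or.inl ⟨M, hM, fun e he x hx => ⟨hMU e he x hx, ?_⟩⟩
    rintro rfl
    exact hp e he hx

/-- Adding an edge to a matching. -/
theorem HasMatchingIn.add_edge {a b : V} (h : HasMatchingIn G k (U \ {a, b})) (hab : G.Adj a b)
    (ha : a ∈ U) (hb : b ∈ U) : HasMatchingIn G (k + 1) U := by
  classical
  obtain ⟨M, hM, hMU⟩ := h
  have hdisj : ∀ f ∈ M, ∀ x ∈ f, x ∉ s(a, b) := fun f hf x hx hxab =>
    (hMU f hf x hx).2 (Sym2.mem_iff.1 hxab)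
  have hnot : s(a, b) ∉ M := fun hmem =>
    hdisj _ hmem a (Sym2.mem_mk_left a b) (Sym2.mem_mk_left a b)
  refine ⟨insert s(a, b) M, ⟨?_, ?_, ?_⟩, ?_⟩
  · intro e he
    rcases Finset.mem_insert.1 he with rfl | he
    · exact hab
    · exact hM.1 he
  · rw [Finset.card_insert_of_notMem hnot, hM.2.1]
  · intro e he f hf hne x hxe hxf
    rcases Finset.mem_insert.1 he with rfl | he <;> rcases Finset.mem_insert.1 hf with rfl | hf
    · exact hne rfl
    · exact hdisj f hf x hxf hxe
    · exact hdisj e he x hxe hxf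
    · exact hM.2.2 e he f hf hne x hxe hxf
  · intro e he x hx
    rcases Finset.mem_insert.1 he with rfl | he
    · rcases Sym2.mem_iff.1 hx with rfl | rfl
      · exact ha
      · exact hb
    · exact (hMU e he x hx).1

/-- A matching avoiding `w` also avoids the vertices whose only neighbour is `w`. -/
theorem HasMatchingIn.diff_of_leaf {i w : V} (h : HasMatchingIn G k U) (hw : w ∉ U)
    (hi : ∀ q, G.Adj i q → q = w) : HasMatchingIn G k (U \ {i}) := by
  obtain ⟨M, hM, hMU⟩ := h
  refine ⟨M, hM, fun e he x hx => ⟨hMU e he x hx, ?_⟩⟩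
  rintro rfl
  obtain ⟨q, rfl⟩ := Sym2.mem_iff_exists.1 hx
  have := hi q (hM.1 he)
  exact hw (this ▸ hMU _ he q (Sym2.mem_mk_right x q))

/-- Turns deletion of vertices into restriction of supports, so that only matchings of `G` itself
occur afterwards. -/
theorem hasMatchingIn_deleteVertices {A : Set V} :
    HasMatchingIn (deleteVertices G A) k U ↔ HasMatchingIn G k (U \ A) := by
  have hedge : ∀ e : Sym2 V, e ∈ (deleteVertices G A).edgeSet ↔ e ∈ G.edgeSet ∧ ∀ x ∈ e, x ∉ A := by
    intro e
    induction e with | h a b => ?_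
    simp [deleteVertices]
  constructor
  · rintro ⟨M, hM, hMU⟩
    exact ⟨M, ⟨fun e he => ((hedge e).1 (hM.1 he)).1, hM.2⟩,
      fun e he x hx => ⟨hMU e he x hx, ((hedge e).1 (hM.1 he)).2 x hx⟩⟩
  · rintro ⟨M, hM, hMU⟩
    exact ⟨M, ⟨fun e he => (hedge e).2 ⟨hM.1 he, fun x hx => (hMU e he x hx).2⟩, hM.2⟩,
      fun e he x hx => (hMU e he x hx).1⟩

theorem IsKMatching.card_matchingVertices [Fintype V] {M : Finset (Sym2 V)}
    (hM : IsKMatching G k M) : (matchingVertices M).card = 2 * k := by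
  classical
  have : matchingVertices M = M.biUnion Sym2.toFinset := by
    ext x
    simp [matchingVertices]
  rw [this, Finset.card_biUnion, Finset.sum_const_nat (m := 2), hM.2.1, mul_comm]
  · intro e he
    exact Sym2.card_toFinset_of_not_isDiag e (G.not_isDiag_of_mem_edgeSet (hM.1 he))
  · intro e he f hf hne
    refine Finset.disjoint_left.2 fun x hxe hxf => ?_
    exact hM.2.2 e he f hf hne x (Sym2.mem_toFinset.1 hxe) (Sym2.mem_toFinset.1 hxf)

theorem isSupportIdeal_squarefreePower (K : Type*) [Field K] [Fintype V] (G : SimpleGraph V)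
    (k : ℕ) : IsSupportIdeal (squarefreePower K G k) (HasMatchingIn G k) := by
  classical
  have hset : {f : MvPolynomial V K | ∃ M, IsKMatching G k M ∧ f = ∏ x ∈ matchingVertices M, X x} =
      (fun s => monomial s (1 : K)) '' {s | ∃ M, IsKMatching G k M ∧
        s = ∑ x ∈ matchingVertices M, Finsupp.single x 1} := by
    ext f
    constructor
    · rintro ⟨M, hM, rfl⟩
      exact ⟨_, ⟨M, hM, rfl⟩, monomial_sum_one _ _⟩
    · rintro ⟨_, ⟨M, hM, rfl⟩, rfl⟩
      exact ⟨M, hM, monomial_sum_one _ _⟩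
  intro f
  rw [squarefreePower, hset, mem_ideal_span_monomial_image]
  simp only [mem_support_iff]
  refine forall₂_congr fun s _ => ?_
  have happ : ∀ (T : Finset V) (x : V),
      (∑ y ∈ T, Finsupp.single y 1 : V →₀ ℕ) x = if x ∈ T then 1 else 0 := by
    intro T x
    simp [Finsupp.finsetSum_apply, Finsupp.single_apply]
  constructor
  · rintro ⟨_, ⟨M, hM, rfl⟩, hle⟩
    refine ⟨M, hM, fun e he x hx => ?_⟩
    have := hle x
    rw [happ, if_pos (by simp only [matchingVertices, Finset.mem_filter, Finset.mem_univ, true_and]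
                         exact ⟨e, he, hx⟩)] at this
    exact Nat.one_le_iff_ne_zero.1 this
  · rintro ⟨M, hM, hMs⟩
    refine ⟨_, ⟨M, hM, rfl⟩, fun x => ?_⟩
    rw [happ]
    split_ifs with hx
    · simp only [matchingVertices, Finset.mem_filter, Finset.mem_univ, true_and] at hx
      obtain ⟨e, he, hxe⟩ := hx
      exact Nat.one_le_iff_ne_zero.2 (hMs e he x hxe)
    · exact Nat.zero_le _

end Matchings

/-! ## Distant edges -/

section Generators

variable {σ K : Type*} [Field K] {I I₁ I₂ : Ideal (MvPolynomial σ K)} {P P₁ P₂ : Set σ → Prop}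

theorem eq_of_le_of_degree_le {s t : σ →₀ ℕ} (hst : t ≤ s) (h : s.degree ≤ t.degree) : s = t := by
  obtain ⟨r, rfl⟩ := exists_add_of_le hst
  rw [map_add] at h
  have : r = 0 := (Finsupp.degree_eq_zero_iff r).1 (by omega)
  rw [this, add_zero]

theorem degree_le_degree_of_le {s t : σ →₀ ℕ} (hst : t ≤ s) : t.degree ≤ s.degree := by
  obtain ⟨r, rfl⟩ := exists_add_of_le hst
  rw [map_add]
  omega

/-- Generators of `I₁` avoid `v` and monomials of `I₂` involve it, which gives disjointness and
excludes divisors from `I₂`. A generator of `I₂` has the least degree `d` possible in `I₁`, so a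
divisor from `I₁` must equal it. -/
theorem minimalMonomialGenerators_eq_union (hI : IsSupportIdeal I P) (h₁ : IsSupportIdeal I₁ P₁)
    (h₂ : IsSupportIdeal I₂ P₂) (hP : ∀ U, P U ↔ P₁ U ∨ P₂ U) {v : σ}
    (hv₁ : ∀ U, P₁ U → P₁ (U \ {v})) (hv₂ : ∀ U, P₂ U → v ∈ U) {d : ℕ}
    (hd₁ : ∀ s : σ →₀ ℕ, P₁ (Function.support s) → d ≤ s.degree)
    (hd₂ : ∀ s : σ →₀ ℕ, P₂ (Function.support s) →
      ∃ t ≤ s, P₂ (Function.support t) ∧ t.degree = d) :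
    minimalMonomialGenerators I = minimalMonomialGenerators I₁ ∪ minimalMonomialGenerators I₂ ∧
      Disjoint (minimalMonomialGenerators I₁) (minimalMonomialGenerators I₂) := by
  have hv : ∀ s : σ →₀ ℕ, Minimal (fun t : σ →₀ ℕ => P₁ (Function.support t)) s → s v = 0 := by
    intro s hs
    have hle : s.erase v ≤ s := fun x => by
      classical
      rw [Finsupp.erase_apply]
      split_ifs <;> simp
    have := hs.2 (y := s.erase v) (by
      change P₁ _
      rw [support_erase']
      exact hv₁ _ hs.1) hle v
    simpa using this
  simp only [minimalMonomialGenerators, hI.monomial_mem_iff, h₁.monomial_mem_iff,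
    h₂.monomial_mem_iff]
  constructor
  · ext s
    constructor
    · intro hs
      rcases (hP _).1 hs.1 with h | h
      · exact Or.inl ⟨h, fun t ht => hs.2 ((hP _).2 (Or.inl ht))⟩
      · exact Or.inr ⟨h, fun t ht => hs.2 ((hP _).2 (Or.inr ht))⟩
    · rintro (hs | hs)
      · refine ⟨(hP _).2 (Or.inl hs.1), fun t ht hts => ?_⟩
        rcases (hP _).1 ht with h | h
        · exact hs.2 h hts
        · have h0 := hts v
          rw [hv s hs] at h0
          exact absurd (Nat.le_zero.1 h0) (hv₂ _ h)
      · refine ⟨(hP _).2 (Or.inr hs.1), fun t ht hts => ?_⟩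
        rcases (hP _).1 ht with h | h
        · obtain ⟨r, hr, hrP, hrd⟩ := hd₂ s hs.1
          have hsr := degree_le_degree_of_le (hs.2 hrP hr)
          exact (eq_of_le_of_degree_le hts ((hsr.trans hrd.le).trans (hd₁ t h))).le
        · exact hs.2 h hts
  · rw [Set.disjoint_left]
    intro s hs₁ hs₂
    exact hv₂ _ hs₂.1 (hv s hs₁)

variable {V : Type*} [Fintype V] {G : SimpleGraph V} {k : ℕ}

theorem HasMatchingIn.exists_degree_eq {s : V →₀ ℕ} (h : HasMatchingIn G k (Function.support s)) :
    ∃ t ≤ s, HasMatchingIn G k (Function.support t) ∧ t.degree = 2 * k := by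
  classical
  obtain ⟨M, hM, hMs⟩ := h
  have happ : ∀ x : V, (∑ y ∈ matchingVertices M, Finsupp.single y 1 : V →₀ ℕ) x =
      if ∃ e ∈ M, x ∈ e then 1 else 0 := by
    intro x
    simp [Finsupp.finsetSum_apply, Finsupp.single_apply, matchingVertices]
  refine ⟨∑ y ∈ matchingVertices M, Finsupp.single y 1, fun x => ?_, ⟨M, hM, fun e he x hx => ?_⟩,
    ?_⟩
  · rw [happ]
    split_ifs with hx
    · obtain ⟨e, he, hxe⟩ := hx
      exact Nat.one_le_iff_ne_zero.2 (hMs e he x hxe)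
    · exact Nat.zero_le _
  · rw [Function.mem_support, happ, if_pos ⟨e, he, hx⟩]
    exact one_ne_zero
  · rw [map_sum, ← hM.card_matchingVertices]
    simp

theorem HasMatchingIn.two_mul_le_degree {s : V →₀ ℕ} (h : HasMatchingIn G k (Function.support s)) :
    2 * k ≤ s.degree := by
  obtain ⟨t, hts, -, ht⟩ := h.exists_degree_eq
  exact ht ▸ degree_le_degree_of_le hts

theorem HasMatchingIn.exists_degree_eq_of_edge {s : V →₀ ℕ} {v w : V} (hvw : v ≠ w)
    (hv : s v ≠ 0) (hw : s w ≠ 0) (h : HasMatchingIn G k (Function.support s \ {v, w})) :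
    ∃ t ≤ s, (t v ≠ 0 ∧ t w ≠ 0 ∧ HasMatchingIn G k (Function.support t \ {v, w})) ∧
      t.degree = 2 * (k + 1) := by
  classical
  have hsupp : Function.support ((s.erase v).erase w) = Function.support s \ {v, w} := by
    rw [support_erase', support_erase', Set.sdiff_sdiff, Set.singleton_union]
  rw [← hsupp] at h
  obtain ⟨t, hts, ht, hdeg⟩ := h.exists_degree_eq
  have htvw : ∀ x, t x ≤ if x = v ∨ x = w then 0 else s x := by
    intro x
    have := hts x
    rw [Finsupp.erase_apply, Finsupp.erase_apply] at this
    by_cases h1 : x = v <;> by_cases h2 : x = w <;> simp_all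
  refine ⟨t + (Finsupp.single v 1 + Finsupp.single w 1), fun x => ?_, ⟨?_, ?_, ?_⟩, ?_⟩
  · have := htvw x
    simp only [Finsupp.add_apply, Finsupp.single_apply]
    by_cases h1 : x = v
    · subst h1
      simp only [true_or, if_true, Ne.symm hvw, if_false] at this ⊢
      omega
    · by_cases h2 : x = w
      · subst h2
        simp only [or_true, if_true, hvw, if_false] at this ⊢
        omega
      · simp only [h1, h2, or_self, if_false, Ne.symm h1, Ne.symm h2] at this ⊢
        omega
  · simp
  · simp
  · refine ht.mono fun x hx => ⟨?_, fun hxvw => hx ?_⟩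
    · rw [Function.mem_support, Finsupp.add_apply]
      exact fun h0 => hx (Nat.eq_zero_of_add_eq_zero h0).1
    · have := htvw x
      rw [if_pos (by simpa using hxvw)] at this
      exact Nat.le_zero.1 this
  · rw [map_add, map_add, hdeg, Finsupp.degree_single, Finsupp.degree_single]
    ring

end Generators

/-! ### Matchings near a distant edge -/

section DistantEdge

variable {V : Type*} {G : SimpleGraph V} {v w u : V} {n : ℕ} {U : Set V}

/-- The monomials of `x_v x_w I(G_2)^{[n]}`. -/
def EdgeMatching (G : SimpleGraph V) (v w : V) (n : ℕ) (U : Set V) : Prop :=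
  v ∈ U ∧ w ∈ U ∧ HasMatchingIn G n (U \ {v, w})

/-- The monomials of `I(G_3)^{[n+1]} + x_u I(G_3)^{[n]} + ∑_i x_i I(G_2)^{[n]}`. -/
def ColonMatching (G : SimpleGraph V) (v w u : V) (n : ℕ) (U : Set V) : Prop :=
  (HasMatchingIn G (n + 1) (U \ {v, w, u}) ∨ u ∈ U ∧ HasMatchingIn G n (U \ {v, w, u})) ∨
    ∃ i, (G.Adj w i ∧ i ≠ u ∧ i ≠ v) ∧ i ∈ U ∧ HasMatchingIn G n (U \ {v, w})

theorem hasMatchingIn_succ_iff (hwv : G.Adj w v) (hv : ∀ q, G.Adj v q → q = w) :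
    HasMatchingIn G (n + 1) U ↔ HasMatchingIn G (n + 1) (U \ {v}) ∨ EdgeMatching G v w n U := by
  constructor
  · intro h
    rcases h.diff_or v with h | ⟨hvU, q, hqU, hq, h⟩
    · exact Or.inl h
    · obtain rfl := hv q hq
      exact Or.inr ⟨hvU, hqU, h⟩
  · rintro (h | ⟨hv, hw, h⟩)
    · exact h.mono Set.sdiff_subset
    · exact h.add_edge hwv.symm hv hw

/-- Look at the edge at `w` of a matching avoiding `v`. If there is none, dropping a possible edge
at `u` lands in one of the first two summands; the edge `wu` gives the second, an edge to a leaf the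
last. Conversely, `wu` or the leaf edge enlarges the `n`-matching. -/
theorem inter_matching_iff (huv : u ≠ v) (hwv : G.Adj w v) (hwu : G.Adj w u)
    (hleaf : ∀ i, G.Adj w i → i ≠ u → i ≠ v → ∀ q, G.Adj i q → q = w) :
    HasMatchingIn G (n + 1) (U \ {v}) ∧ EdgeMatching G v w n U ↔
      v ∈ U ∧ w ∈ U ∧ ColonMatching G v w u n U := by
  have hsub : ∀ {W : Set V}, W ⊆ U \ {v, w} → W ⊆ U \ {v} := fun hW x hx =>
    ⟨(hW hx).1, fun h => (hW hx).2 (Or.inl h)⟩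
  have hsub3 : U \ {v, w, u} ⊆ U \ {v, w} := fun x hx =>
    ⟨hx.1, fun h => hx.2 (h.imp_right Or.inl)⟩
  constructor
  · rintro ⟨h, hvU, hwU, h'⟩
    refine ⟨hvU, hwU, ?_⟩
    rcases h.diff_or w with h | ⟨-, q, ⟨hqU, hqv⟩, hq, h⟩
    · rcases h.diff_or u with h | ⟨huU, q, -, -, h⟩
      · exact Or.inl (Or.inl (h.mono fun x hx => by
          simp only [Set.mem_sdiff, Set.mem_insert_iff, Set.mem_singleton_iff] at hx ⊢
          tauto))
      · exact Or.inl (Or.inr ⟨huU.1.1, h.mono fun x hx => by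
          simp only [Set.mem_sdiff, Set.mem_insert_iff, Set.mem_singleton_iff] at hx ⊢
          tauto⟩)
    · by_cases hqu : q = u
      · subst hqu
        exact Or.inl (Or.inr ⟨hqU, h.mono fun x hx => by
          simp only [Set.mem_sdiff, Set.mem_insert_iff, Set.mem_singleton_iff] at hx ⊢
          tauto⟩)
      · exact Or.inr ⟨q, ⟨hq, hqu, hqv⟩, hqU, h'⟩
  · rintro ⟨hvU, hwU, (h | ⟨huU, h⟩) | ⟨i, ⟨hi, hiu, hiv⟩, hiU, h⟩⟩
    · exact ⟨h.mono (hsub hsub3), hvU, hwU, h.of_succ.mono hsub3⟩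
    · refine ⟨HasMatchingIn.add_edge (h.mono fun x hx => ?_) hwu ⟨hwU, hwv.ne⟩ ⟨huU, huv⟩,
        hvU, hwU, h.mono hsub3⟩
      simp only [Set.mem_sdiff, Set.mem_insert_iff, Set.mem_singleton_iff] at hx ⊢
      tauto
    · refine ⟨HasMatchingIn.add_edge ((h.diff_of_leaf (fun hw => hw.2 (Or.inr rfl))
        (hleaf i hi hiu hiv)).mono fun x hx => ?_) hi ⟨hwU, hwv.ne⟩ ⟨hiU, hiv⟩, hvU, hwU, h⟩
      simp only [Set.mem_sdiff, Set.mem_insert_iff, Set.mem_singleton_iff] at hx ⊢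
      tauto

theorem EdgeMatching.diff {x : V} (hv : v ∈ U) (hw : w ∈ U) (hxv : x ≠ v) (hxw : x ≠ w)
    (h : HasMatchingIn G n ((U \ {v, w}) \ {x})) : EdgeMatching G v w n (U \ {x}) :=
  ⟨⟨hv, Ne.symm hxv⟩, ⟨hw, Ne.symm hxw⟩, h.mono fun y hy => by
    simp only [Set.mem_sdiff, Set.mem_insert_iff, Set.mem_singleton_iff] at hy ⊢
    tauto⟩

theorem EdgeMatching.mono {W : Set V} (h : EdgeMatching G v w n U) (hUW : U ⊆ W) :
    EdgeMatching G v w n W :=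
  ⟨hUW h.1, hUW h.2.1, h.2.2.mono fun _ hx => ⟨hUW hx.1, hx.2⟩⟩

/-- For every set of variables `A` there is a variable `p` in `A` such that the monomials with
support in `A` of the intersection remain in `x_v x_w I(G_2)^{[n]}` after setting `x_p = 1`. -/
theorem exists_forall_edgeMatching_diff (huv : u ≠ v) (hwv : G.Adj w v) (hwu : G.Adj w u)
    (hleaf : ∀ i, G.Adj w i → i ≠ u → i ≠ v → ∀ q, G.Adj i q → q = w) {A : Set V} {U₀ : Set V}
    (hU₀A : U₀ ⊆ A) (hU₀ : HasMatchingIn G (n + 1) (U₀ \ {v}) ∧ EdgeMatching G v w n U₀) :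
    ∃ p ∈ A, ∀ U ⊆ A, HasMatchingIn G (n + 1) (U \ {v}) ∧ EdgeMatching G v w n U →
      EdgeMatching G v w n (U \ {p}) := by
  -- An edge at such a leaf ends in `w`, which the `n`-matching avoids.
  by_cases hA : ∃ i ∈ A, G.Adj w i ∧ i ≠ u ∧ i ≠ v
  · obtain ⟨i, hiA, hi, hiu, hiv⟩ := hA
    refine ⟨i, hiA, fun U hU h => EdgeMatching.diff h.2.1 h.2.2.1 hiv hi.ne' ?_⟩
    exact h.2.2.2.diff_of_leaf (fun hw => hw.2 (Or.inr rfl)) (hleaf i hi hiu hiv)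
  push Not at hA
  have hcolon : ∀ U ⊆ A, HasMatchingIn G (n + 1) (U \ {v}) ∧ EdgeMatching G v w n U →
      v ∈ U ∧ w ∈ U ∧ (HasMatchingIn G (n + 1) (U \ {v, w, u}) ∨
        u ∈ U ∧ HasMatchingIn G n (U \ {v, w, u})) := by
    intro U hU h
    obtain ⟨hvU, hwU, h | ⟨i, ⟨hi, hiu, hiv⟩, hiU, -⟩⟩ :=
      (inter_matching_iff huv hwv hwu hleaf).1 h
    · exact ⟨hvU, hwU, h⟩
    · exact absurd (hA i (hU hiU) hi hiu) hiv
  -- Without leaves in `A` only the first two summands remain, and both supply an `n`-matching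
  -- avoiding `u`.
  by_cases hu : u ∈ A
  · refine ⟨u, hu, fun U hU h => ?_⟩
    obtain ⟨hvU, hwU, h⟩ := hcolon U hU h
    refine EdgeMatching.diff hvU hwU huv hwu.ne' ?_
    have : HasMatchingIn G n (U \ {v, w, u}) := h.elim (fun h => h.of_succ) fun h => h.2
    refine this.mono fun x hx => ?_
    simp only [Set.mem_sdiff, Set.mem_insert_iff, Set.mem_singleton_iff] at hx ⊢
    tauto
  · have hcolon' : ∀ U ⊆ A, HasMatchingIn G (n + 1) (U \ {v}) ∧ EdgeMatching G v w n U →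
        v ∈ U ∧ w ∈ U ∧ HasMatchingIn G (n + 1) (U \ {v, w, u}) := by
      intro U hU h
      obtain ⟨hvU, hwU, h⟩ := hcolon U hU h
      exact ⟨hvU, hwU, h.resolve_right fun h => hu (hU h.1)⟩
    obtain ⟨-, -, h₀⟩ := hcolon' U₀ hU₀A hU₀
    -- Only the first summand is left, so there is one edge to spare and any vertex of `A` outside
    -- {v, w, u} works; `U₀` provides one.
    obtain ⟨p, hpU₀, hp⟩ := h₀.exists_mem
    refine ⟨p, hU₀A hpU₀, fun U hU h => ?_⟩
    obtain ⟨hvU, hwU, h⟩ := hcolon' U hU h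
    refine EdgeMatching.diff hvU hwU (fun h => hp (Or.inl h)) (fun h => hp (Or.inr (Or.inl h))) ?_
    refine (h.of_succ_diff p).mono fun x hx => ?_
    simp only [Set.mem_sdiff, Set.mem_insert_iff, Set.mem_singleton_iff] at hx ⊢
    tauto

end DistantEdge

/-! ### Supports for the ideals of the splitting -/

section Ideals

variable (K : Type*) [Field K] {V : Type*} (G : SimpleGraph V)

theorem isSupportIdeal_squarefreePower_deleteVertices [Fintype V] (A : Set V) (k : ℕ) :
    IsSupportIdeal (squarefreePower K (deleteVertices G A) k)
      fun U => HasMatchingIn G k (U \ A) := by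
  have := isSupportIdeal_squarefreePower K (deleteVertices G A) k
  intro f
  simp only [this f, hasMatchingIn_deleteVertices]

theorem monotone_hasMatchingIn_diff (A : Set V) (k : ℕ) :
    Monotone fun U => HasMatchingIn G k (U \ A) :=
  fun _ _ hUW h => h.mono (Set.sdiff_subset_sdiff_left hUW)

variable {G}

theorem hasMatchingIn_diff_diff_of_mem {A : Set V} {p : V} (hp : p ∈ A) {k : ℕ} {U : Set V}
    (h : HasMatchingIn G k (U \ A)) : HasMatchingIn G k ((U \ {p}) \ A) :=
  h.mono fun _ hx => ⟨⟨hx.1, fun hxp => hx.2 (by rw [hxp]; exact hp)⟩, hx.2⟩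

theorem isSupportIdeal_X_mul_X_mul {v w : V} (hvw : v ≠ w) {I : Ideal (MvPolynomial V K)}
    {P : Set V → Prop} (hI : IsSupportIdeal I P) (hP : Monotone P)
    (hv : ∀ U, P U → P (U \ {v})) (hw : ∀ U, P U → P (U \ {w})) :
    IsSupportIdeal (Ideal.span {X v * X w} * I) fun U => v ∈ U ∧ w ∈ U ∧ P U := by
  rw [← Ideal.span_singleton_mul_span_singleton, mul_assoc]
  exact (hI.X_mul hP hw).X_mul (fun U W hUW h => ⟨hUW h.1, hP hUW h.2⟩)
    fun U h => ⟨⟨h.1, hvw.symm⟩, hv U h.2⟩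

end Ideals

end

/-! ### The Betti splitting and the intersection formula -/

theorem mainTheorem4 (K : Type*) [Field K] {V : Type*} [Fintype V] [DecidableEq V]
    (G : SimpleGraph V) [DecidableRel G.Adj]
    (hforest : G.IsAcyclic) (hν : 3 ≤ matchingNumber G)
    -- `v, w, u` are the vertices `n, n - 1, n - 2`
    (v w u : V) (huv : u ≠ v)
    (hwv : G.Adj w v) (hwu : G.Adj w u)
    (hv : G.degree v = 1)
    (hleaf : ∀ i, G.Adj w i → i ≠ u → i ≠ v → G.degree i = 1)
    (k : ℕ) (hk1 : 1 ≤ k) (hk : k ≤ matchingNumber G) :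
    IsBettiSplitting (squarefreePower K G k)
      (squarefreePower K (deleteVertices G {v}) k)
      (Ideal.span {X v * X w} * squarefreePower K (deleteVertices G {v, w}) (k - 1)) ∧
    squarefreePower K (deleteVertices G {v}) k ⊓
        (Ideal.span {X v * X w} * squarefreePower K (deleteVertices G {v, w}) (k - 1)) =
      Ideal.span {X v * X w} *
        (squarefreePower K (deleteVertices G {v, w, u}) k +
          Ideal.span {X u} * squarefreePower K (deleteVertices G {v, w, u}) (k - 1) +
          ∑ i ∈ (G.neighborFinset w) \ {u, v},
            Ideal.span {X i} * squarefreePower K (deleteVertices G {v, w}) (k - 1)) := by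
  obtain ⟨n, rfl⟩ : ∃ n, k = n + 1 := ⟨k - 1, by omega⟩
  rw [Nat.add_sub_cancel]
  have hdeg : ∀ i, G.Adj w i → G.degree i = 1 → ∀ q, G.Adj i q → q = w := by
    intro i hi hdi q hq
    obtain ⟨a, -, ha⟩ := SimpleGraph.degree_eq_one_iff_existsUnique_adj.1 hdi
    rw [ha q hq, ha w hi.symm]
  have hv' := hdeg v hwv hv
  have hleaf' : ∀ i, G.Adj w i → i ≠ u → i ≠ v → ∀ q, G.Adj i q → q = w :=
    fun i hi hiu hiv => hdeg i hi (hleaf i hi hiu hiv)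
  have hI := isSupportIdeal_squarefreePower K G (n + 1)
  have h₁ := isSupportIdeal_squarefreePower_deleteVertices K G {v} (n + 1)
  have hG₂ := isSupportIdeal_squarefreePower_deleteVertices K G {v, w} n
  have h₂ := isSupportIdeal_X_mul_X_mul K hwv.ne' hG₂ (monotone_hasMatchingIn_diff G _ _)
    (fun U => hasMatchingIn_diff_diff_of_mem (by simp))
    (fun U => hasMatchingIn_diff_diff_of_mem (by simp))
  have hm₁ : Monotone fun U => HasMatchingIn G (n + 1) (U \ {v}) :=
    monotone_hasMatchingIn_diff G _ _
  have hm₂ : Monotone fun U => v ∈ U ∧ w ∈ U ∧ HasMatchingIn G n (U \ {v, w}) :=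
    fun U W hUW h => EdgeMatching.mono h hUW
  have h₁₂ := h₁.inf h₂
  have hsum : squarefreePower K G (n + 1) = squarefreePower K (deleteVertices G {v}) (n + 1) ⊔
      Ideal.span {X v * X w} * squarefreePower K (deleteVertices G {v, w}) n :=
    hI.eq (h₁.sup h₂) fun U => hasMatchingIn_succ_iff hwv hv'
  have hmon := hI.isMonomialIdeal fun U W hUW h => h.mono hUW
  have hmon₁ := h₁.isMonomialIdeal hm₁
  have hmon₂ := h₂.isMonomialIdeal hm₂
  have hmon₁₂ := h₁₂.isMonomialIdeal fun U W hUW h => ⟨hm₁ hUW h.1, hm₂ hUW h.2⟩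
  have hsupp : ∀ {s α : V →₀ ℕ}, s ≤ α → Function.support s ⊆ Function.support α :=
    fun {s α} hs x hx h0 => hx (Nat.le_zero.1 ((hs x).trans h0.le))
  have hbetti := gradedBetti_sup hmon₁ hmon₂ hmon₁₂ (hsum ▸ hmon)
    (by
      rintro α ⟨s, hs, hsI⟩
      -- The first ideal does not involve `x_v`, while every monomial of the intersection does.
      refine ⟨v, hsupp hs ((h₁₂.monomial_mem_iff s).1 hsI).2.1, fun t _ htI => ?_⟩
      rw [h₁.monomial_mem_iff, support_erase']
      exact hasMatchingIn_diff_diff_of_mem (by simp) ((h₁₂.monomial_mem_iff t).1 htI).1)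
    (by
      rintro α ⟨s, hs, hsI⟩
      obtain ⟨p, hp, hpA⟩ := exists_forall_edgeMatching_diff huv hwv hwu hleaf' (hsupp hs)
        ((h₁₂.monomial_mem_iff s).1 hsI)
      refine ⟨p, hp, fun t ht htI => ?_⟩
      rw [h₂.monomial_mem_iff, support_erase']
      exact hpA _ (hsupp ht) ((h₁₂.monomial_mem_iff t).1 htI))
  rw [← hsum] at hbetti
  have hgen := minimalMonomialGenerators_eq_union hI h₁ h₂
    (fun U => hasMatchingIn_succ_iff hwv hv') (v := v) (d := 2 * (n + 1))
    (fun U => hasMatchingIn_diff_diff_of_mem (by simp)) (fun U h => h.1)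
    (fun s h => (h.mono Set.sdiff_subset).two_mul_le_degree)
    (fun s h => HasMatchingIn.exists_degree_eq_of_edge hwv.ne' h.1 h.2.1 h.2.2)
  refine ⟨⟨hmon, hmon₁, hmon₂, hsum, hgen.1, hgen.2, hbetti.1, hbetti.2⟩, ?_⟩
  have hG₃ := isSupportIdeal_squarefreePower_deleteVertices K G {v, w, u}
  have hcolon : IsSupportIdeal (squarefreePower K (deleteVertices G {v, w, u}) (n + 1) +
      Ideal.span {X u} * squarefreePower K (deleteVertices G {v, w, u}) n +
      ∑ i ∈ (G.neighborFinset w) \ {u, v},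
        Ideal.span {X i} * squarefreePower K (deleteVertices G {v, w}) n)
      (ColonMatching G v w u n) := by
    have hi := isSupportIdeal_sum ((G.neighborFinset w) \ {u, v}) fun i hi =>
      hG₂.X_mul (p := i) (monotone_hasMatchingIn_diff G _ _) fun U h => by
        simp only [Finset.mem_sdiff, SimpleGraph.mem_neighborFinset, Finset.mem_insert,
          Finset.mem_singleton, not_or] at hi
        refine (h.diff_of_leaf (fun hw => hw.2 (Or.inr rfl))
          (hleaf' i hi.1 hi.2.1 hi.2.2)).mono fun x hx => ⟨⟨hx.1.1, hx.2⟩, hx.1.2⟩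
    have := ((hG₃ (n + 1)).sup ((hG₃ n).X_mul (p := u) (monotone_hasMatchingIn_diff G _ _)
      fun U => hasMatchingIn_diff_diff_of_mem (by simp))).sup hi
    rw [Submodule.add_eq_sup, Submodule.add_eq_sup]
    simp only [Finset.mem_sdiff, SimpleGraph.mem_neighborFinset, Finset.mem_insert,
      Finset.mem_singleton, not_or] at this
    exact this
  refine h₁₂.eq (isSupportIdeal_X_mul_X_mul K hwv.ne' hcolon ?_ ?_ ?_) fun U =>
    inter_matching_iff huv hwv hwu hleaf'
  · rintro U W hUW ((h | ⟨hu, h⟩) | ⟨i, hi, hiU, h⟩)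
    · exact Or.inl (Or.inl (monotone_hasMatchingIn_diff G _ _ hUW h))
    · exact Or.inl (Or.inr ⟨hUW hu, monotone_hasMatchingIn_diff G _ _ hUW h⟩)
    · exact Or.inr ⟨i, hi, hUW hiU, monotone_hasMatchingIn_diff G _ _ hUW h⟩
  · rintro U ((h | ⟨hu, h⟩) | ⟨i, hi, hiU, h⟩)
    · exact Or.inl (Or.inl (hasMatchingIn_diff_diff_of_mem (by simp) h))
    · exact Or.inl (Or.inr ⟨⟨hu, huv⟩, hasMatchingIn_diff_diff_of_mem (by simp) h⟩)
    · exact Or.inr ⟨i, hi, ⟨hiU, hi.2.2⟩, hasMatchingIn_diff_diff_of_mem (by simp) h⟩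
  · rintro U ((h | ⟨hu, h⟩) | ⟨i, hi, hiU, h⟩)
    · exact Or.inl (Or.inl (hasMatchingIn_diff_diff_of_mem (by simp) h))
    · exact Or.inl (Or.inr ⟨⟨hu, hwu.ne'⟩, hasMatchingIn_diff_diff_of_mem (by simp) h⟩)
    · exact Or.inr ⟨i, hi, ⟨hiU, hi.1.ne'⟩, hasMatchingIn_diff_diff_of_mem (by simp) h⟩
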